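/- Let $A\in\mathbb{R}^{m\times m}$, $B\in\mathbb{R}^{m\times r}$, and let $Q\in\mathbb{R}^{m\times m}$, $R\in\mathbb{R}^{r\times r}$ be symmetric positive definite. Let the $r$ inputs be split among $n\ge 1$ subsystems, with $r=r_1+\dots+r_n$, and let $R$ be block diagonal with respect to this splitting (nothing of the kind is required of $A$, $B$, $Q$; block-diagonal $Q$ is a special case). Consider the problem of controlling $\dot x=Ax+Bu$, $x(0)=x_0$, with minimal cost $\int_0^\infty (x^{\mathsf T}Qx+u^{\mathsf T}Ru)\,dt$ over all locally integrable controls $u$. For a feedback $F\in\mathbb{R}^{r\times m}$ let $V_F(x_0)\in[0,\infty]$ be the cost of $u=Fx$. Write $\mathrm{CARE}(A,B,Q,R)$ for the equation $A^{\mathsf T}P+PA-PBR^{-1}B^{\mathsf T}P+Q=0$. Let $\Pi_i\in\mathbb{R}^{r\times r_i}$ be the block column $(0,\dots,0,I,0,\dots,0)^{\mathsf T}$ with $I$ in the $i$-th block, and for a feedback $F$ put $$A^{(i)}=A+B(I-\Pi_i\Pi_i^{\mathsf T})F,\qquad B^{(i)}=B\Pi_i,$$ $$Q^{(i)}=Q+F^{\mathsf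 T}(I-\Pi_i\Pi_i^{\mathsf T})R(I-\Pi_i\Pi_i^{\mathsf T})F,\qquad R^{(i)}=\Pi_i^{\mathsf T}R\,\Pi_i.$$ Updating subsystem $i$ at $F$ means: take a symmetric positive definite solution $P$ of $\mathrm{CARE}(A^{(i)},B^{(i)},Q^{(i)},R^{(i)})$ and replace the $i$-th block row of $F$ by $-(R^{(i)})^{-1}(B^{(i)})^{\mathsf T}P$, keeping the other block rows. The split optimal policy iteration starts from $F^0$ and updates the subsystems $i,i+1,\dots,n,1,2,\dots$ cyclically; $F^{k}$ is the feedback after $k$ updates and $P^k$ ($k\ge1$) the Riccati solution used in the $k$-th update. **Theorem.** Let $F^0$ be any feedback and $i$ any subsystem, and suppose that the pair $(A^{(i)},B^{(i)})$ formed with $F=F^0$ is controllable (Kalman rank condition). Then the iteration started at $F^0$ with subsystem $i$ is well defined: there is exactly one sequence $(F^k)_{k\ge0}$, $(P^k)_{k\ge1}$ as above. The equation $\mathrm{CARE}(A,B,Q,R)$ has exactly one symmetric positive definite solution $P^{\rm opt}$; the feedback $F^{\rm opt}=-R^{-1}B^{\mathsf T}P^{\rm opt}$ is the unique optimal feedback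 of the original problem, and $V_{F^{\rm opt}}(x)=x^{\mathsf T}P^{\rm opt}x$ for all $x$. Moreover: (i) for all $k\ge1$, $F^k$ stabilizes the full system, i.e. all trajectories of $\dot x=(A+BF^k)x$ tend to $0$; (ii) $V_{F^{k+1}}\le V_{F^k}$ pointwise for all $k\ge0$ (where $V_{F^0}$ may be infinite); for $k\ge1$, $V_{F^k}(x)=x^{\mathsf T}P^kx$ for all $x$, and $P^{k+1}\preceq P^k$ (that is, $P^k-P^{k+1}$ is positive semidefinite); (iii) $F^k\to F^{\rm opt}$ as $k\to\infty$; and whenever a feedback $G$ is a fixed point of the updates of all subsystems $j=1,\dots,n$, with Riccati solutions $S_j$, then every $S_j$ solves the full equation $\mathrm{CARE}(A,B,Q,R)$, and $G=F^{\rm opt}$. -/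

import Mathlib

open Filter Topology MeasureTheory Matrix

noncomputable section

namespace SplitLQR

section LQR

variable {ι κ : Type*} [Fintype ι] [DecidableEq ι] [Fintype κ] [DecidableEq κ]

/-- The pair `(A, B)` is controllable: the Kalman matrix `[B, A B, …, A^(m-1) B]`, with `m` the
dimension of the state space, has rank `m`. -/
def IsControllable (A : Matrix ι ι ℝ) (B : Matrix ι κ ℝ) : Prop :=
  (Matrix.of fun (a : ι) (p : Fin (Fintype.card ι) × κ) => (A ^ (p.1 : ℕ) * B) a p.2).rank
    = Fintype.card ι

/-- `P` is a symmetric positive definite solution of the continuous algebraic Riccati equation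
`Aᵀ P + P A - P B R⁻¹ Bᵀ P + Q = 0`. -/
def IsCARESolution (A : Matrix ι ι ℝ) (B : Matrix ι κ ℝ) (Q : Matrix ι ι ℝ) (R : Matrix κ κ ℝ)
    (P : Matrix ι ι ℝ) : Prop :=
  P.PosDef ∧ Aᵀ * P + P * A - P * B * R⁻¹ * Bᵀ * P + Q = 0

/-- The feedback matrix `-R⁻¹ Bᵀ P`. -/
def feedback (B : Matrix ι κ ℝ) (R : Matrix κ κ ℝ) (P : Matrix ι ι ℝ) : Matrix κ ι ℝ :=
  -(R⁻¹ * Bᵀ * P)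

/-- `x` is the state trajectory on `[0, ∞)` of `x' = A x + B u`, `x(0) = x₀`, for the locally
integrable control `u` (Carathéodory solution, written as an integral equation). -/
structure IsTrajectory (A : Matrix ι ι ℝ) (B : Matrix ι κ ℝ) (x₀ : ι → ℝ)
    (u : ℝ → κ → ℝ) (x : ℝ → ι → ℝ) : Prop where
  control_integrable : ∀ t : ℝ, 0 ≤ t → IntervalIntegrable u volume 0 t
  state_continuous : ContinuousOn x (Set.Ici 0)
  state_eq : ∀ t : ℝ, 0 ≤ t → x t = x₀ + ∫ s in (0 : ℝ)..t, (A *ᵥ x s + B *ᵥ u s)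

/-- The accumulated cost `∫₀^∞ xᵀ Q x + uᵀ R u dt`, with values in `[0, ∞]`. -/
def cost (Q : Matrix ι ι ℝ) (R : Matrix κ κ ℝ) (u : ℝ → κ → ℝ) (x : ℝ → ι → ℝ) : ENNReal :=
  ∫⁻ t in Set.Ici (0 : ℝ), ENNReal.ofReal (x t ⬝ᵥ (Q *ᵥ x t) + u t ⬝ᵥ (R *ᵥ u t))

/-- The state at time `t` of the closed loop `x' = (A + B F) x`, `x(0) = x₀`. -/
def closedLoop (A : Matrix ι ι ℝ) (B : Matrix ι κ ℝ) (F : Matrix κ ι ℝ) (x₀ : ι → ℝ) (t : ℝ) :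
    ι → ℝ :=
  NormedSpace.exp (t • (A + B * F)) *ᵥ x₀

/-- `F` stabilizes the system: every trajectory of the (linear, time-invariant) closed loop
converges to the origin. -/
def IsStabilizing (A : Matrix ι ι ℝ) (B : Matrix ι κ ℝ) (F : Matrix κ ι ℝ) : Prop :=
  ∀ x₀ : ι → ℝ, Tendsto (closedLoop A B F x₀) atTop (𝓝 0)

/-- The value function of the feedback `F`: the cost of the control `u = F x` as a function of the
initial state (it is infinite where that cost is infinite). -/
def value (A : Matrix ι ι ℝ) (B : Matrix ι κ ℝ) (Q : Matrix ι ι ℝ) (R : Matrix κ κ ℝ)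
    (F : Matrix κ ι ℝ) (x₀ : ι → ℝ) : ENNReal :=
  cost Q R (fun t => F *ᵥ closedLoop A B F x₀ t) (closedLoop A B F x₀)

/-- `F` is an optimal feedback: from every initial state its cost is minimal among the costs of
all controls. -/
def IsOptimalFeedback (A : Matrix ι ι ℝ) (B : Matrix ι κ ℝ) (Q : Matrix ι ι ℝ)
    (R : Matrix κ κ ℝ) (F : Matrix κ ι ℝ) : Prop :=
  ∀ (x₀ : ι → ℝ) (u : ℝ → κ → ℝ) (x : ℝ → ι → ℝ),
    IsTrajectory A B x₀ u x → value A B Q R F x₀ ≤ cost Q R u x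

end LQR

section Split

variable {m n : ℕ} {r : Fin n → ℕ}

/-- Input indices: `⟨i, a⟩` is the `a`-th input of the `i`-th of `n` subsystems, which has `r i`
inputs. -/
abbrev Inputs (r : Fin n → ℕ) : Type := (i : Fin n) × Fin (r i)

/-- `R` is block diagonal with respect to the subsystem decomposition. -/
def IsBlockDiag (R : Matrix (Inputs r) (Inputs r) ℝ) : Prop :=
  ∀ p q : Inputs r, p.1 ≠ q.1 → R p q = 0

/-- The block column matrix `Π_i = (0, …, 0, I, 0, …, 0)ᵀ`. -/
def blockCol (r : Fin n → ℕ) (i : Fin n) : Matrix (Inputs r) (Fin (r i)) ℝ :=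
  Matrix.of fun p a => if p = ⟨i, a⟩ then 1 else 0

/-- `I - Π_i Π_iᵀ`. -/
def coProj (r : Fin n → ℕ) (i : Fin n) : Matrix (Inputs r) (Inputs r) ℝ :=
  1 - blockCol r i * (blockCol r i)ᵀ

/-- `A^(i) = A + B (I - Π_i Π_iᵀ) F`. -/
def subA (A : Matrix (Fin m) (Fin m) ℝ) (B : Matrix (Fin m) (Inputs r) ℝ) (i : Fin n)
    (F : Matrix (Inputs r) (Fin m) ℝ) : Matrix (Fin m) (Fin m) ℝ :=
  A + B * coProj r i * F

/-- `B^(i) = B Π_i`. -/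
def subB (B : Matrix (Fin m) (Inputs r) ℝ) (i : Fin n) : Matrix (Fin m) (Fin (r i)) ℝ :=
  B * blockCol r i

/-- `Q^(i) = Q + Fᵀ (I - Π_i Π_iᵀ) R (I - Π_i Π_iᵀ) F`. -/
def subQ (Q : Matrix (Fin m) (Fin m) ℝ) (R : Matrix (Inputs r) (Inputs r) ℝ) (i : Fin n)
    (F : Matrix (Inputs r) (Fin m) ℝ) : Matrix (Fin m) (Fin m) ℝ :=
  Q + Fᵀ * coProj r i * R * coProj r i * F

/-- `R^(i) = Π_iᵀ R Π_i`. -/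
def subR (R : Matrix (Inputs r) (Inputs r) ℝ) (i : Fin n) : Matrix (Fin (r i)) (Fin (r i)) ℝ :=
  (blockCol r i)ᵀ * R * blockCol r i

/-- One step of the split optimal policy iteration, updating the `i`-th subsystem: `P` is a
symmetric positive definite solution of the Riccati equation of the `i`-th subproblem at the
feedback `F`, the `i`-th block row of `Fnew` is the resulting feedback, and the other block rows of
`Fnew` are those of `F`. -/
structure IsSplitStep (A : Matrix (Fin m) (Fin m) ℝ) (B : Matrix (Fin m) (Inputs r) ℝ)
    (Q : Matrix (Fin m) (Fin m) ℝ) (R : Matrix (Inputs r) (Inputs r) ℝ) (i : Fin n)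
    (F : Matrix (Inputs r) (Fin m) ℝ) (P : Matrix (Fin m) (Fin m) ℝ)
    (Fnew : Matrix (Inputs r) (Fin m) ℝ) : Prop where
  care : IsCARESolution (subA A B i F) (subB B i) (subQ Q R i F) (subR R i) P
  updated : (blockCol r i)ᵀ * Fnew = feedback (subB B i) (subR R i) P
  unchanged : coProj r i * Fnew = coProj r i * F

/-- The subsystem updated in step `k` (counted from `0`) of the cyclic sweep that starts with
subsystem `i`. -/
def sweep (i : Fin n) (k : ℕ) : Fin n :=
  ⟨(i.val + k) % n, Nat.mod_lt _ i.pos⟩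

/-- `F 0, F 1, …` are the iterates of the split optimal policy iteration started at `F₀` with
subsystem `i`, and `P 1, P 2, …` the Riccati solutions that produce `F 1, F 2, …`
(`P 0` plays no role). -/
structure IsSplitIteration (A : Matrix (Fin m) (Fin m) ℝ) (B : Matrix (Fin m) (Inputs r) ℝ)
    (Q : Matrix (Fin m) (Fin m) ℝ) (R : Matrix (Inputs r) (Inputs r) ℝ) (i : Fin n)
    (F₀ : Matrix (Inputs r) (Fin m) ℝ) (F : ℕ → Matrix (Inputs r) (Fin m) ℝ)
    (P : ℕ → Matrix (Fin m) (Fin m) ℝ) : Prop where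
  init : F 0 = F₀
  step : ∀ k : ℕ, IsSplitStep A B Q R (sweep i k) (F k) (P (k + 1)) (F (k + 1))

end Split

end SplitLQR

end

/-! When $R$ is block diagonal, freezing all block rows of $F$ except the $i$-th turns the full
problem into an LQR problem for subsystem $i$ with the same dynamics and cost. Its Riccati equation,
read at the updated feedback, is the Lyapunov equation $(A+BF)^{\mathsf T}P+P(A+BF)+Q+F^{\mathsf
T}RF=0$ of the full closed loop (`IsSplitStep.lyapunov`), in which $i$ no longer occurs. Hence the
new feedback stabilizes the full system and its cost is $x^{\mathsf T}Px$. The old feedback is an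
admissible control of the subproblem, so its cost is no smaller (`IsSplitStep.ofReal_le_value`).
Since the new feedback stabilizes, its own block rows stabilize every later subproblem, and
controllability is needed only once, through Bass' construction.

Riccati solutions come from Kleinman's iteration, started at any stabilizing feedback; their
uniqueness and the optimality of their feedbacks come from completing the square along arbitrary
trajectories.

For convergence, the $P^k$ decrease in the Loewner order to some $L$. Every block row is refreshed
infinitely often from ever later $P^k$, so $F^k\to-R^{-1}B^{\mathsf T}L$, and the limit of the
Lyapunov equations is the full Riccati equation for $L$. -/

namespace SplitLQR

/-! ### Quadratic forms, Lyapunov equations and stability -/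

section Lyapunov

variable {ι : Type*} [Fintype ι]

theorem hasDerivAt_dotProduct_mulVec (M : Matrix ι ι ℝ) {y z : ℝ → ι → ℝ} {y' z' : ι → ℝ} {t : ℝ}
    (hy : HasDerivAt y y' t) (hz : HasDerivAt z z' t) :
    HasDerivAt (fun s => y s ⬝ᵥ (M *ᵥ z s)) (y' ⬝ᵥ (M *ᵥ z t) + y t ⬝ᵥ (M *ᵥ z')) t := by
  have hyc := hasDerivAt_pi.1 hy
  have hzc := hasDerivAt_pi.1 hz
  have h2 : ∀ i, HasDerivAt (fun s => (M *ᵥ z s) i) ((M *ᵥ z') i) t := fun i => by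
    simp only [Matrix.mulVec, dotProduct]
    exact HasDerivAt.fun_sum fun j _ => (hzc j).const_mul _
  have h3 := HasDerivAt.fun_sum (u := Finset.univ) fun i _ => (hyc i).fun_mul (h2 i)
  simp only [Finset.sum_add_distrib] at h3
  exact h3

theorem dotProduct_lyapunov (A M : Matrix ι ι ℝ) (x z : ι → ℝ) :
    (A *ᵥ x) ⬝ᵥ (M *ᵥ z) + x ⬝ᵥ (M *ᵥ (A *ᵥ z)) = x ⬝ᵥ ((Aᵀ * M + M * A) *ᵥ z) := by
  rw [Matrix.add_mulVec, dotProduct_add, ← Matrix.mulVec_mulVec, ← Matrix.mulVec_mulVec,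
    Matrix.dotProduct_mulVec x Aᵀ, Matrix.vecMul_transpose]

theorem continuous_quadratic (M : Matrix ι ι ℝ) :
    Continuous fun x : ι → ℝ => x ⬝ᵥ (M *ᵥ x) := by
  fun_prop

theorem quadratic_smul (M : Matrix ι ι ℝ) (c : ℝ) (x : ι → ℝ) :
    (c • x) ⬝ᵥ (M *ᵥ (c • x)) = c ^ 2 * (x ⬝ᵥ (M *ᵥ x)) := by
  simp only [Matrix.mulVec_smul, smul_dotProduct, dotProduct_smul, smul_eq_mul]
  ring

theorem quadratic_ge_of_sphere (M : Matrix ι ι ℝ) (c : ℝ)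
    (h : ∀ x : ι → ℝ, ‖x‖ = 1 → c ≤ x ⬝ᵥ (M *ᵥ x)) (x : ι → ℝ) :
    c * ‖x‖ ^ 2 ≤ x ⬝ᵥ (M *ᵥ x) := by
  rcases eq_or_ne x 0 with rfl | hx
  · simp
  have hn : ‖x‖ ≠ 0 := norm_ne_zero_iff.2 hx
  have h1 := h (‖x‖⁻¹ • x) (by rw [norm_smul, norm_inv, norm_norm, inv_mul_cancel₀ hn])
  rw [quadratic_smul] at h1
  have h2 : 0 < ‖x‖ ^ 2 := by positivity
  calc c * ‖x‖ ^ 2 ≤ (‖x‖⁻¹ ^ 2 * (x ⬝ᵥ (M *ᵥ x))) * ‖x‖ ^ 2 := by gcongr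
    _ = x ⬝ᵥ (M *ᵥ x) := by field_simp

theorem posDef_iff_quadratic {M : Matrix ι ι ℝ} :
    M.PosDef ↔ Mᵀ = M ∧ ∀ x : ι → ℝ, x ≠ 0 → 0 < x ⬝ᵥ (M *ᵥ x) := by
  rw [Matrix.posDef_iff_dotProduct_mulVec, Matrix.IsHermitian,
    Matrix.conjTranspose_eq_transpose_of_trivial]
  simp only [star_trivial]

theorem posSemidef_iff_quadratic {M : Matrix ι ι ℝ} :
    M.PosSemidef ↔ Mᵀ = M ∧ ∀ x : ι → ℝ, 0 ≤ x ⬝ᵥ (M *ᵥ x) := by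
  rw [Matrix.posSemidef_iff_dotProduct_mulVec, Matrix.IsHermitian,
    Matrix.conjTranspose_eq_transpose_of_trivial]
  simp only [star_trivial]

theorem exists_quadratic_ge {M : Matrix ι ι ℝ} (hM : M.PosDef) :
    ∃ c : ℝ, 0 < c ∧ ∀ x : ι → ℝ, c * ‖x‖ ^ 2 ≤ x ⬝ᵥ (M *ᵥ x) := by
  have hx : ∀ x ∈ Metric.sphere (0 : ι → ℝ) 1, 0 < x ⬝ᵥ (M *ᵥ x) := fun x hx =>
    (posDef_iff_quadratic.1 hM).2 x (by
      rintro rfl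
      simp at hx)
  obtain ⟨c, hc, h⟩ := (isCompact_sphere (0 : ι → ℝ) 1).exists_forall_le'
    (continuous_quadratic M).continuousOn hx
  exact ⟨c, hc, quadratic_ge_of_sphere M c fun x hx => h x (by simpa using hx)⟩

theorem exists_quadratic_le (M : Matrix ι ι ℝ) :
    ∃ C : ℝ, 0 < C ∧ ∀ x : ι → ℝ, x ⬝ᵥ (M *ᵥ x) ≤ C * ‖x‖ ^ 2 := by
  obtain ⟨C, hC⟩ := (isCompact_sphere (0 : ι → ℝ) 1).exists_bound_of_continuousOn
    (continuous_quadratic (-M)).continuousOn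
  refine ⟨max C 1, by positivity, fun x => ?_⟩
  have h := quadratic_ge_of_sphere (-M) (-max C 1) (fun y hy => by
    have h1 := hC y (by simpa using hy)
    rw [Real.norm_eq_abs] at h1
    linarith [neg_abs_le (y ⬝ᵥ (-M *ᵥ y)), le_max_left C 1]) x
  rw [Matrix.neg_mulVec, dotProduct_neg] at h
  linarith

/-- The constant serves as a decay rate for $x^{\mathsf T}Px$ in the stability proof and lets the
running cost dominate the storage function in the optimality proofs. -/
theorem exists_smul_quadratic_le {M : Matrix ι ι ℝ} (hM : M.PosDef) (P : Matrix ι ι ℝ) :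
    ∃ c : ℝ, 0 < c ∧ ∀ x : ι → ℝ, c * (x ⬝ᵥ (P *ᵥ x)) ≤ x ⬝ᵥ (M *ᵥ x) := by
  obtain ⟨a, ha, h1⟩ := exists_quadratic_ge hM
  obtain ⟨C, hC, h2⟩ := exists_quadratic_le P
  refine ⟨a / C, by positivity, fun x => ?_⟩
  calc a / C * (x ⬝ᵥ (P *ᵥ x)) ≤ a / C * (C * ‖x‖ ^ 2) := by gcongr; exact h2 x
    _ = a * ‖x‖ ^ 2 := by field_simp
    _ ≤ _ := h1 x

/-- A positive semidefinite solution of a Lyapunov equation with positive definite right-hand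
side is positive definite. -/
theorem posDef_of_lyapunov {A P M : Matrix ι ι ℝ} (hP : P.PosSemidef)
    (hM : M.PosDef) (h : Aᵀ * P + P * A + M = 0) : P.PosDef := by
  obtain ⟨hPt, hP0⟩ := posSemidef_iff_quadratic.1 hP
  refine posDef_iff_quadratic.2 ⟨hPt, fun x hx => (hP0 x).lt_of_ne fun h0 => ?_⟩
  have hPx : P *ᵥ x = 0 := by
    have := (hP.dotProduct_mulVec_zero_iff x).1 (by simpa using h0.symm)
    exact this
  -- Pairing the equation with a vector $x$ of $\ker P$ kills both terms containing $P$ and leaves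
  -- $x^{\mathsf T}Mx=0$.
  have h1 := dotProduct_lyapunov A P x x
  rw [eq_neg_of_add_eq_zero_left h, hPx, Matrix.dotProduct_mulVec x P, ← Matrix.mulVec_transpose,
    hPt, hPx, Matrix.neg_mulVec] at h1
  have h2 := (posDef_iff_quadratic.1 hM).2 x hx
  simp at h1
  linarith

variable [DecidableEq ι]

theorem eq_zero_of_quadratic_eq_zero {D : Matrix ι ι ℝ} (hD : Dᵀ = D)
    (h : ∀ x : ι → ℝ, x ⬝ᵥ (D *ᵥ x) = 0) : D = 0 := by
  ext i j
  have h1 := h (Pi.single i 1 + Pi.single j 1)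
  have h2 := h (Pi.single i 1)
  have h3 := h (Pi.single j 1)
  have h4 : D j i = D i j := congrFun (congrFun hD i) j
  simp only [Matrix.mulVec_add, dotProduct_add, add_dotProduct, Matrix.mulVec_single_one,
    single_one_dotProduct, Matrix.col_apply] at h1 h2 h3
  simp only [Matrix.zero_apply]
  linarith

theorem eq_of_quadratic_eq {P S : Matrix ι ι ℝ} (hP : Pᵀ = P) (hS : Sᵀ = S)
    (h : ∀ x : ι → ℝ, x ⬝ᵥ (P *ᵥ x) = x ⬝ᵥ (S *ᵥ x)) : P = S := by
  refine sub_eq_zero.1 (eq_zero_of_quadratic_eq_zero (by rw [transpose_sub, hP, hS]) fun x => ?_)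
  rw [Matrix.sub_mulVec, dotProduct_sub, h, sub_self]

theorem hasDerivAt_exp_mulVec (A : Matrix ι ι ℝ) (x : ι → ℝ) (t : ℝ) :
    HasDerivAt (fun s : ℝ => NormedSpace.exp (s • A) *ᵥ x)
      (A *ᵥ (NormedSpace.exp (t • A) *ᵥ x)) t := by
  let : NormedRing (Matrix ι ι ℝ) := Matrix.linftyOpNormedRing
  let : NormedAlgebra ℝ (Matrix ι ι ℝ) := Matrix.linftyOpNormedAlgebra
  have h := hasDerivAt_exp_smul_const' (𝕂 := ℝ) A t
  let L : Matrix ι ι ℝ →ₗ[ℝ] (ι → ℝ) :=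
    { toFun := fun M => M *ᵥ x
      map_add' := fun M N => Matrix.add_mulVec M N x
      map_smul' := fun c M => Matrix.smul_mulVec c M x }
  have h2 := (LinearMap.toContinuousLinearMap L).hasFDerivAt.comp_hasDerivAt t h
  rw [Matrix.mulVec_mulVec]
  exact h2

theorem exp_zero_smul_mulVec (A : Matrix ι ι ℝ) (x : ι → ℝ) :
    NormedSpace.exp ((0 : ℝ) • A) *ᵥ x = x := by
  simp [NormedSpace.exp_zero]

theorem hasDerivAt_bilin_exp (A M : Matrix ι ι ℝ) (x z : ι → ℝ) (t : ℝ) :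
    HasDerivAt (fun s : ℝ => (NormedSpace.exp (s • A) *ᵥ x) ⬝ᵥ
        (M *ᵥ (NormedSpace.exp (s • A) *ᵥ z)))
      ((NormedSpace.exp (t • A) *ᵥ x) ⬝ᵥ ((Aᵀ * M + M * A) *ᵥ (NormedSpace.exp (t • A) *ᵥ z)))
      t := by
  rw [← dotProduct_lyapunov]
  exact hasDerivAt_dotProduct_mulVec M (hasDerivAt_exp_mulVec A x t) (hasDerivAt_exp_mulVec A z t)

/-- All trajectories of `x' = A x` converge to the origin. -/
def IsHurwitz (A : Matrix ι ι ℝ) : Prop :=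
  ∀ x : ι → ℝ, Tendsto (fun t : ℝ => NormedSpace.exp (t • A) *ᵥ x) atTop (𝓝 0)

theorem IsHurwitz.tendsto_quadratic {A : Matrix ι ι ℝ} (hA : IsHurwitz A) (M : Matrix ι ι ℝ)
    (x : ι → ℝ) :
    Tendsto (fun s : ℝ => (NormedSpace.exp (s • A) *ᵥ x) ⬝ᵥ
        (M *ᵥ (NormedSpace.exp (s • A) *ᵥ x))) atTop (𝓝 0) := by
  have h := ((continuous_quadratic M).tendsto 0).comp (hA x)
  simpa [Function.comp_def] using h

/-- With $cP\preceq M$, the function $V=x^{\mathsf T}Px$ satisfies $V'\le -cV$ along trajectories,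
so $e^{ct}V$ decreases; since $V$ dominates $a\|x\|^2$, the state decays exponentially. -/
theorem isHurwitz_of_lyapunov {A P M : Matrix ι ι ℝ} (hP : P.PosDef) (hM : M.PosDef)
    (h : Aᵀ * P + P * A + M = 0) : IsHurwitz A := by
  intro x
  obtain ⟨c, hc, hcM⟩ := exists_smul_quadratic_le hM P
  obtain ⟨a, ha, haP⟩ := exists_quadratic_ge hP
  set φ : ℝ → ι → ℝ := fun t => NormedSpace.exp (t • A) *ᵥ x with hφ
  set V : ℝ → ℝ := fun t => φ t ⬝ᵥ (P *ᵥ φ t) with hV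
  have hV' : ∀ t, HasDerivAt V (-(φ t ⬝ᵥ (M *ᵥ φ t))) t := fun t => by
    have := hasDerivAt_bilin_exp A P x x t
    rwa [eq_neg_of_add_eq_zero_left h, Matrix.neg_mulVec, dotProduct_neg] at this
  have hE : ∀ t, HasDerivAt (fun s => Real.exp (c * s) * V s)
      (Real.exp (c * t) * c * V t + Real.exp (c * t) * (-(φ t ⬝ᵥ (M *ᵥ φ t)))) t := fun t => by
    have h1 : HasDerivAt (fun s => Real.exp (c * s)) (Real.exp (c * t) * c) t := by
      simpa using ((hasDerivAt_id t).const_mul c).exp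
    exact h1.mul (hV' t)
  have hanti : Antitone fun s => Real.exp (c * s) * V s :=
    antitone_of_hasDerivAt_nonpos hE fun t => by
      have h1 := hcM (φ t)
      have h2 := Real.exp_pos (c * t)
      change Real.exp (c * t) * c * V t + Real.exp (c * t) * (-(φ t ⬝ᵥ (M *ᵥ φ t))) ≤ 0
      have h3 : Real.exp (c * t) * (c * V t - φ t ⬝ᵥ (M *ᵥ φ t)) ≤ 0 :=
        mul_nonpos_of_nonneg_of_nonpos h2.le (by linarith)
      linarith
  have hbound : ∀ t, 0 ≤ t → ‖φ t‖ ^ 2 ≤ V 0 / a * Real.exp (-(c * t)) := fun t ht => by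
    have h1 := hanti ht
    simp only [mul_zero, Real.exp_zero, one_mul] at h1
    have h2 := haP (φ t)
    rw [Real.exp_neg]
    have h3 := Real.exp_pos (c * t)
    rw [div_mul_eq_mul_div, ← div_eq_mul_inv, div_div, le_div_iff₀ (by positivity)]
    calc ‖φ t‖ ^ 2 * (Real.exp (c * t) * a) = Real.exp (c * t) * (a * ‖φ t‖ ^ 2) := by ring
      _ ≤ Real.exp (c * t) * V t := by gcongr
      _ ≤ V 0 := h1
  have hlim : Tendsto (fun t => V 0 / a * Real.exp (-(c * t))) atTop (𝓝 0) := by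
    have h1 : Tendsto (fun t : ℝ => c * t) atTop atTop := tendsto_id.const_mul_atTop hc
    simpa using (Real.tendsto_exp_neg_atTop_nhds_zero.comp h1).const_mul (V 0 / a)
  have hsq : Tendsto (fun t => ‖φ t‖ ^ 2) atTop (𝓝 0) :=
    squeeze_zero' (Eventually.of_forall fun t => by positivity)
      ((eventually_ge_atTop 0).mono hbound) hlim
  have hn : Tendsto (fun t => ‖φ t‖) atTop (𝓝 0) := by
    have h1 := (Real.continuous_sqrt.tendsto 0).comp hsq
    simpa [Function.comp_def] using h1
  exact tendsto_zero_iff_norm_tendsto_zero.2 hn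

theorem antitone_quadratic_of_lyapunov {A P M : Matrix ι ι ℝ} (h : Aᵀ * P + P * A + M = 0)
    (hM : ∀ x : ι → ℝ, 0 ≤ x ⬝ᵥ (M *ᵥ x)) (x : ι → ℝ) :
    Antitone fun s : ℝ => (NormedSpace.exp (s • A) *ᵥ x) ⬝ᵥ
        (P *ᵥ (NormedSpace.exp (s • A) *ᵥ x)) := by
  refine antitone_of_hasDerivAt_nonpos (hasDerivAt_bilin_exp A P x x) fun t => ?_
  change _ ≤ (0 : ℝ)
  rw [eq_neg_of_add_eq_zero_left h, Matrix.neg_mulVec, dotProduct_neg]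
  exact neg_nonpos.2 (hM _)

theorem IsHurwitz.quadratic_nonneg {A P M : Matrix ι ι ℝ} (hA : IsHurwitz A)
    (h : Aᵀ * P + P * A + M = 0) (hM : ∀ x : ι → ℝ, 0 ≤ x ⬝ᵥ (M *ᵥ x)) (x : ι → ℝ) :
    0 ≤ x ⬝ᵥ (P *ᵥ x) := by
  have h1 := (antitone_quadratic_of_lyapunov h hM x).le_of_tendsto (hA.tendsto_quadratic P x) 0
  simpa using h1

/-- The bilinear form of $P$ along two trajectories is constant in time and tends to $0$. Two
trajectories are used because $P$ need not be symmetric. -/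
theorem IsHurwitz.eq_zero_of_lyapunov {A P : Matrix ι ι ℝ} (hA : IsHurwitz A)
    (h : Aᵀ * P + P * A = 0) : P = 0 := by
  have hb : ∀ x z : ι → ℝ, x ⬝ᵥ (P *ᵥ z) = 0 := fun x z => by
    have h1 : ∀ s t : ℝ, (NormedSpace.exp (s • A) *ᵥ x) ⬝ᵥ (P *ᵥ (NormedSpace.exp (s • A) *ᵥ z)) =
        (NormedSpace.exp (t • A) *ᵥ x) ⬝ᵥ (P *ᵥ (NormedSpace.exp (t • A) *ᵥ z)) :=
      is_const_of_deriv_eq_zero (fun t => (hasDerivAt_bilin_exp A P x z t).differentiableAt)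
        fun t => by rw [(hasDerivAt_bilin_exp A P x z t).deriv, h]; simp
    have hc : Continuous fun p : (ι → ℝ) × (ι → ℝ) => p.1 ⬝ᵥ (P *ᵥ p.2) := by fun_prop
    have h2 := (hc.tendsto (0, 0)).comp ((hA x).prodMk_nhds (hA z))
    have h3 := tendsto_nhds_unique h2 (tendsto_const_nhds.congr fun t => h1 0 t)
    simpa using h3.symm
  ext i j
  simpa using hb (Pi.single i 1) (Pi.single j 1)

/-- The Lyapunov operator is injective on a finite-dimensional space, hence surjective; no integral
formula for the solution is needed. -/
theorem IsHurwitz.exists_lyapunov {A : Matrix ι ι ℝ} (hA : IsHurwitz A) (M : Matrix ι ι ℝ) :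
    ∃ P : Matrix ι ι ℝ, Aᵀ * P + P * A + M = 0 := by
  let L : Matrix ι ι ℝ →ₗ[ℝ] Matrix ι ι ℝ :=
    LinearMap.mulLeft ℝ Aᵀ + LinearMap.mulRight ℝ A
  have hinj : Function.Injective L := (injective_iff_map_eq_zero L).2 fun P hP =>
    hA.eq_zero_of_lyapunov (by simpa [L] using hP)
  obtain ⟨P, hP⟩ := LinearMap.surjective_of_injective hinj (-M)
  exact ⟨P, by rw [← neg_add_cancel M, ← hP, add_comm]; simp [L]; abel⟩

theorem IsHurwitz.transpose_eq_of_lyapunov {A P M : Matrix ι ι ℝ} (hA : IsHurwitz A)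
    (hM : Mᵀ = M) (h : Aᵀ * P + P * A + M = 0) : Pᵀ = P := by
  refine sub_eq_zero.1 (hA.eq_zero_of_lyapunov ?_)
  have h1 := congrArg Matrix.transpose h
  simp only [Matrix.transpose_add, Matrix.transpose_mul, Matrix.transpose_transpose, hM,
    Matrix.transpose_zero] at h1
  calc Aᵀ * (Pᵀ - P) + (Pᵀ - P) * A
      = (Pᵀ * A + Aᵀ * Pᵀ + M) - (Aᵀ * P + P * A + M) := by noncomm_ring
    _ = 0 := by rw [h, h1, sub_zero]

theorem IsHurwitz.posSemidef_of_lyapunov {A P M : Matrix ι ι ℝ} (hA : IsHurwitz A)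
    (hM : M.PosSemidef) (h : Aᵀ * P + P * A + M = 0) : P.PosSemidef := by
  obtain ⟨h1, h2⟩ := posSemidef_iff_quadratic.1 hM
  exact posSemidef_iff_quadratic.2 ⟨hA.transpose_eq_of_lyapunov h1 h, hA.quadratic_nonneg h h2⟩

theorem IsHurwitz.exists_posDef_lyapunov {A M : Matrix ι ι ℝ} (hA : IsHurwitz A) (hM : M.PosDef) :
    ∃ P : Matrix ι ι ℝ, P.PosDef ∧ Aᵀ * P + P * A + M = 0 := by
  obtain ⟨P, hP⟩ := hA.exists_lyapunov M
  exact ⟨P, posDef_of_lyapunov (hA.posSemidef_of_lyapunov hM.posSemidef hP) hM hP, hP⟩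

/-- A sequence of positive semidefinite matrices that decreases in the Loewner order converges. -/
theorem exists_tendsto_of_loewner_antitone {P : ℕ → Matrix ι ι ℝ} (hP : ∀ k, (P k).PosSemidef)
    (hanti : ∀ k, (P k - P (k + 1)).PosSemidef) :
    ∃ L : Matrix ι ι ℝ, L.PosSemidef ∧ Tendsto P atTop (𝓝 L) := by
  have hq : ∀ x : ι → ℝ, ∃ l, Tendsto (fun k => x ⬝ᵥ (P k *ᵥ x)) atTop (𝓝 l) := fun x => by
    have h1 : Antitone fun k => x ⬝ᵥ (P k *ᵥ x) := antitone_nat_of_succ_le fun k => by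
      have h2 := (posSemidef_iff_quadratic.1 (hanti k)).2 x
      rw [Matrix.sub_mulVec, dotProduct_sub] at h2
      linarith
    exact ⟨_, tendsto_atTop_ciInf h1
      ⟨0, by rintro _ ⟨k, rfl⟩; exact (posSemidef_iff_quadratic.1 (hP k)).2 x⟩⟩
  choose q hq using hq
  -- The quadratic forms converge by monotonicity; polarization recovers the matrix entries from
  -- their limits.
  let L : Matrix ι ι ℝ := Matrix.of fun i j =>
    (q (Pi.single i 1 + Pi.single j 1) - q (Pi.single i 1) - q (Pi.single j 1)) / 2
  have hL : Tendsto P atTop (𝓝 L) := by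
    refine tendsto_pi_nhds.2 fun i => tendsto_pi_nhds.2 fun j => ?_
    have h1 := (((hq (Pi.single i 1 + Pi.single j 1)).sub (hq (Pi.single i 1))).sub
      (hq (Pi.single j 1))).div_const 2
    refine h1.congr fun k => ?_
    have h4 : P k j i = P k i j :=
      congrFun (congrFun (posSemidef_iff_quadratic.1 (hP k)).1 i) j
    simp only [Matrix.mulVec_add, dotProduct_add, add_dotProduct, Matrix.mulVec_single_one,
      single_one_dotProduct, Matrix.col_apply]
    linarith
  refine ⟨L, posSemidef_iff_quadratic.2 ⟨?_, fun x => ?_⟩, hL⟩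
  · have h1 : Tendsto (fun k => (P k)ᵀ) atTop (𝓝 Lᵀ) :=
      ((continuous_id.matrix_transpose).tendsto L).comp hL
    refine tendsto_nhds_unique h1 (hL.congr fun k => ?_)
    exact (posSemidef_iff_quadratic.1 (hP k)).1.symm
  · have hc : Continuous fun M : Matrix ι ι ℝ => x ⬝ᵥ (M *ᵥ x) := by fun_prop
    exact ge_of_tendsto' ((hc.tendsto L).comp hL) fun k => (posSemidef_iff_quadratic.1 (hP k)).2 x

end Lyapunov

/-! ### Stabilizing controllable pairs and solving the Riccati equation -/

section Riccati

variable {ι κ : Type*} [Fintype ι] [Fintype κ]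

theorem posSemidef_transpose_mul_mul {R : Matrix κ κ ℝ} (hR : R.PosDef) (K : Matrix κ ι ℝ) :
    (Kᵀ * R * K).PosSemidef := by
  have := hR.posSemidef.conjTranspose_mul_mul_same K
  rwa [Matrix.conjTranspose_eq_transpose_of_trivial] at this

theorem posDef_add_transpose_mul_mul {Q : Matrix ι ι ℝ} {R : Matrix κ κ ℝ} (hQ : Q.PosDef)
    (hR : R.PosDef) (K : Matrix κ ι ℝ) : (Q + Kᵀ * R * K).PosDef :=
  hQ.add_posSemidef (posSemidef_transpose_mul_mul hR K)

theorem eq_zero_of_isControllable [DecidableEq ι] {A : Matrix ι ι ℝ} {B : Matrix ι κ ℝ} (h : IsControllable A B)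
    {x : ι → ℝ} (hx : ∀ k : ℕ, Bᵀ *ᵥ ((Aᵀ ^ k) *ᵥ x) = 0) : x = 0 := by
  set K : Matrix ι (Fin (Fintype.card ι) × κ) ℝ :=
    Matrix.of fun (a : ι) (p : Fin (Fintype.card ι) × κ) => (A ^ (p.1 : ℕ) * B) a p.2 with hK
  have hrank : Kᵀ.rank = Fintype.card ι := by rw [Matrix.rank_transpose]; exact h
  have h1 := LinearMap.finrank_range_add_finrank_ker Kᵀ.mulVecLin
  rw [Module.finrank_fintype_fun_eq_card] at h1
  have h2 : Module.finrank ℝ (LinearMap.ker Kᵀ.mulVecLin) = 0 := by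
    have : Module.finrank ℝ (LinearMap.range Kᵀ.mulVecLin) = Fintype.card ι := hrank
    omega
  have h3 : x ∈ LinearMap.ker Kᵀ.mulVecLin := by
    rw [LinearMap.mem_ker, Matrix.mulVecLin_apply]
    ext p
    have h4 := congrFun (hx p.1) p.2
    rw [Matrix.mulVec_mulVec, ← Matrix.transpose_pow, ← Matrix.transpose_mul] at h4
    exact h4
  rw [Submodule.finrank_eq_zero.1 h2] at h3
  simpa using h3

/-- Bass' construction of a stabilizing feedback for a controllable pair. -/
theorem exists_isHurwitz_of_isControllable [DecidableEq ι] {A : Matrix ι ι ℝ} {B : Matrix ι κ ℝ}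
    (h : IsControllable A B) : ∃ K : Matrix κ ι ℝ, IsHurwitz (A + B * K) := by
  obtain ⟨C, hC, hCle⟩ := exists_quadratic_le (-(A + Aᵀ))
  obtain ⟨c, hc, hcge⟩ := exists_quadratic_ge (Matrix.PosDef.one (n := ι) (R := ℝ))
  -- The shift $b=C/c$ makes $2bI+A+A^{\mathsf T}$ positive definite; $c$ compares $x^{\mathsf T}x$
  -- with the square of the sup norm.
  have hM : ((2 * (C / c)) • (1 : Matrix ι ι ℝ) + (A + Aᵀ)).PosDef := by
    refine posDef_iff_quadratic.2 ⟨by simp [add_comm], fun x hx => ?_⟩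
    have h1 := hCle x
    have h2 := hcge x
    have h3 : 0 < ‖x‖ ^ 2 := by have := norm_pos_iff.2 hx; positivity
    have h4 : 2 * (C / c) * (c * ‖x‖ ^ 2) ≤ 2 * (C / c) * (x ⬝ᵥ ((1 : Matrix ι ι ℝ) *ᵥ x)) := by
      gcongr
    have h5 : 2 * (C / c) * (c * ‖x‖ ^ 2) = 2 * C * ‖x‖ ^ 2 := by field_simp
    rw [Matrix.neg_mulVec, dotProduct_neg] at h1
    rw [Matrix.add_mulVec, dotProduct_add, Matrix.smul_mulVec, dotProduct_smul, smul_eq_mul]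
    nlinarith
  set b := C / c with hb
  have hb0 : 0 < b := by positivity
  have hH : IsHurwitz (-(A + b • (1 : Matrix ι ι ℝ)))ᵀ := by
    refine isHurwitz_of_lyapunov (Matrix.PosDef.one (n := ι) (R := ℝ)) hM ?_
    simp only [Matrix.transpose_transpose, Matrix.transpose_neg, Matrix.transpose_add,
      Matrix.transpose_smul, Matrix.transpose_one, Matrix.mul_one, Matrix.one_mul, mul_smul,
      two_smul]
    abel
  have hBB : (B * Bᵀ).PosSemidef := by
    have := Matrix.posSemidef_self_mul_conjTranspose B
    rwa [Matrix.conjTranspose_eq_transpose_of_trivial] at this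
  obtain ⟨Z, hZ⟩ := hH.exists_lyapunov (B * Bᵀ + B * Bᵀ)
  have hZ0 := hH.posSemidef_of_lyapunov (hBB.add hBB) hZ
  have hZt := (posSemidef_iff_quadratic.1 hZ0).1
  rw [Matrix.transpose_transpose] at hZ
  have hZ2 : A * Z + Z * Aᵀ + (2 * b) • Z = B * Bᵀ + B * Bᵀ := by
    rw [← sub_eq_zero, ← neg_eq_zero, ← hZ]
    simp only [Matrix.transpose_neg, Matrix.transpose_add,
      Matrix.transpose_smul, Matrix.transpose_one, Matrix.mul_one, Matrix.one_mul, mul_smul,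
      two_smul, Matrix.neg_mul, Matrix.mul_neg, Matrix.add_mul, Matrix.mul_add, Matrix.smul_mul,
      Matrix.mul_smul]
    abel
  -- The kernel of $Z$ lies in $\ker B^{\mathsf T}$ and is invariant under $A^{\mathsf T}$, so
  -- controllability forces it to be trivial.
  have hker : ∀ x : ι → ℝ, Z *ᵥ x = 0 → Bᵀ *ᵥ x = 0 ∧ Z *ᵥ (Aᵀ *ᵥ x) = 0 := fun x hx => by
    have h1 := congrArg (· *ᵥ x) hZ2
    simp only [Matrix.add_mulVec, ← Matrix.mulVec_mulVec, Matrix.smul_mulVec, hx,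
      Matrix.mulVec_zero, smul_zero, zero_add, add_zero] at h1
    have h2 := congrArg (x ⬝ᵥ ·) h1
    simp only [dotProduct_add, Matrix.dotProduct_mulVec x Z, Matrix.dotProduct_mulVec x B] at h2
    rw [← Matrix.mulVec_transpose, ← Matrix.mulVec_transpose, hZt, hx, zero_dotProduct] at h2
    have h3 : Bᵀ *ᵥ x = 0 := dotProduct_self_eq_zero.1 (by linarith)
    rw [h3] at h1
    exact ⟨h3, by simpa using h1⟩
  have hZpd : Z.PosDef := by
    refine posDef_iff_quadratic.2 ⟨hZt, fun x hx =>
      ((posSemidef_iff_quadratic.1 hZ0).2 x).lt_of_ne fun h0 => hx ?_⟩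
    have hZx : Z *ᵥ x = 0 := (hZ0.dotProduct_mulVec_zero_iff x).1 (by simpa using h0.symm)
    have hk : ∀ k : ℕ, Z *ᵥ ((Aᵀ ^ k) *ᵥ x) = 0 := fun k => by
      induction k with
      | zero => simpa using hZx
      | succ k ih => rw [pow_succ', ← Matrix.mulVec_mulVec]; exact (hker _ ih).2
    exact eq_zero_of_isControllable h fun k => (hker _ (hk k)).1
  have hu : IsUnit Z.det := (Matrix.isUnit_iff_isUnit_det Z).1 hZpd.isUnit
  -- Multiplying the equation for $Z$ by $Z^{-1}$ on both sides gives the Lyapunov equation of the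
  -- closed loop for $Z^{-1}$, with right-hand matrix $2bZ^{-1}$.
  refine ⟨-(Bᵀ * Z⁻¹),
    isHurwitz_of_lyapunov hZpd.inv (hZpd.inv.smul (by positivity : 0 < 2 * b)) ?_⟩
  have h5 := congrArg (fun X => Z⁻¹ * X * Z⁻¹) hZ2
  simp only [Matrix.mul_add, Matrix.add_mul, Matrix.mul_smul, Matrix.smul_mul, Matrix.mul_assoc,
    Matrix.mul_nonsing_inv _ hu, Matrix.mul_one, Matrix.nonsing_inv_mul_cancel_left _ _ hu] at h5
  have hZit : Z⁻¹ᵀ = Z⁻¹ := (posDef_iff_quadratic.1 hZpd.inv).1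
  simp only [Matrix.transpose_add, Matrix.transpose_mul, Matrix.transpose_neg, hZit,
    Matrix.transpose_transpose, Matrix.mul_add, Matrix.add_mul, Matrix.mul_neg, Matrix.neg_mul,
    Matrix.mul_assoc]
  calc _ = (Z⁻¹ * A + Aᵀ * Z⁻¹ + (2 * b) • Z⁻¹) -
      (Z⁻¹ * (B * (Bᵀ * Z⁻¹)) + Z⁻¹ * (B * (Bᵀ * Z⁻¹))) := by abel
    _ = 0 := by rw [h5, sub_self]

variable [DecidableEq κ]

theorem mul_feedback (B : Matrix ι κ ℝ) {R : Matrix κ κ ℝ} (hR : R.PosDef) (P : Matrix ι ι ℝ) :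
    R * feedback B R P = -(Bᵀ * P) := by
  have hu : IsUnit R.det := (Matrix.isUnit_iff_isUnit_det R).1 hR.isUnit
  rw [feedback, Matrix.mul_neg, Matrix.mul_assoc, Matrix.mul_nonsing_inv_cancel_left _ _ hu]

theorem transpose_feedback_mul (B : Matrix ι κ ℝ) {R : Matrix κ κ ℝ} (hR : R.PosDef)
    {P : Matrix ι ι ℝ} (hP : Pᵀ = P) :
    (feedback B R P)ᵀ * R = -(P * B) := by
  have hRt : Rᵀ = R := (posDef_iff_quadratic.1 hR).1
  have h := congrArg Matrix.transpose (mul_feedback B hR P)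
  rwa [Matrix.transpose_mul, hRt, Matrix.transpose_neg, Matrix.transpose_mul,
    Matrix.transpose_transpose, hP] at h

/-- Completion of squares for matrices. -/
theorem lyapunov_eq_care_add (A : Matrix ι ι ℝ) (B : Matrix ι κ ℝ) (Q : Matrix ι ι ℝ)
    {R : Matrix κ κ ℝ} (hR : R.PosDef) {P : Matrix ι ι ℝ} (hP : Pᵀ = P) (K : Matrix κ ι ℝ) :
    (A + B * K)ᵀ * P + P * (A + B * K) + (Q + Kᵀ * R * K) =
      (Aᵀ * P + P * A - P * B * R⁻¹ * Bᵀ * P + Q) +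
        (K - feedback B R P)ᵀ * R * (K - feedback B R P) := by
  have h1 := mul_feedback B hR P
  have h2 := transpose_feedback_mul B hR hP
  have h3 : P * B * feedback B R P = -(P * B * R⁻¹ * Bᵀ * P) := by
    rw [feedback, Matrix.mul_neg]
    simp only [Matrix.mul_assoc]
  rw [Matrix.transpose_sub, Matrix.sub_mul, Matrix.sub_mul, Matrix.mul_sub, Matrix.mul_sub, h2,
    Matrix.mul_assoc Kᵀ R (feedback B R P), h1]
  simp only [Matrix.neg_mul, h3, Matrix.transpose_add, Matrix.transpose_mul, Matrix.add_mul,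
    Matrix.mul_add, Matrix.mul_neg, Matrix.mul_assoc]
  abel

/-- The square vanishes at $K=-R^{-1}B^{\mathsf T}P$. This exchanges the quadratic Riccati equation
for a Lyapunov equation, to which the stability results apply. -/
theorem lyapunov_feedback_iff (A : Matrix ι ι ℝ) (B : Matrix ι κ ℝ) (Q : Matrix ι ι ℝ)
    {R : Matrix κ κ ℝ} (hR : R.PosDef) {P : Matrix ι ι ℝ} (hP : Pᵀ = P) :
    (A + B * feedback B R P)ᵀ * P + P * (A + B * feedback B R P) +
        (Q + (feedback B R P)ᵀ * R * feedback B R P) = 0 ↔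
      Aᵀ * P + P * A - P * B * R⁻¹ * Bᵀ * P + Q = 0 := by
  rw [lyapunov_eq_care_add A B Q hR hP]
  simp

variable [DecidableEq ι]

/-- One step of Kleinman's iteration, started at a supersolution `P` of the Riccati equation. -/
theorem exists_kleinman_step (A : Matrix ι ι ℝ) (B : Matrix ι κ ℝ) {Q : Matrix ι ι ℝ}
    {R : Matrix κ κ ℝ} (hQ : Q.PosDef) (hR : R.PosDef) {P : Matrix ι ι ℝ} (hP : P.PosDef)
    (hsup : (-(Aᵀ * P + P * A - P * B * R⁻¹ * Bᵀ * P + Q)).PosSemidef) :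
    ∃ S : Matrix ι ι ℝ, (S.PosDef ∧
      (-(Aᵀ * S + S * A - S * B * R⁻¹ * Bᵀ * S + Q)).PosSemidef) ∧ (P - S).PosSemidef ∧
      (A + B * feedback B R P)ᵀ * S + S * (A + B * feedback B R P) +
        (Q + (feedback B R P)ᵀ * R * feedback B R P) = 0 := by
  have hPt : Pᵀ = P := (posDef_iff_quadratic.1 hP).1
  set K := feedback B R P with hK
  have h1 := lyapunov_eq_care_add A B Q hR hPt K
  rw [hK, sub_self, Matrix.mul_zero, add_zero, ← hK] at h1
  set E := Aᵀ * P + P * A - P * B * R⁻¹ * Bᵀ * P + Q with hE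
  have hM := posDef_add_transpose_mul_mul hQ hR K
  have hH : IsHurwitz (A + B * K) := by
    refine isHurwitz_of_lyapunov hP (hM.add_posSemidef hsup) ?_
    rw [← add_assoc, h1, add_neg_cancel]
  obtain ⟨S, hS, hSeq⟩ := hH.exists_posDef_lyapunov hM
  have hSt : Sᵀ = S := (posDef_iff_quadratic.1 hS).1
  -- The Riccati residual of $S$ is minus a square, so $S$ is again a supersolution; $P-S$ solves a
  -- Lyapunov equation with matrix $-E\succeq0$.
  refine ⟨S, ⟨hS, ?_⟩, hH.posSemidef_of_lyapunov hsup ?_, hSeq⟩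
  · have h2 := lyapunov_eq_care_add A B Q hR hSt K
    rw [hSeq] at h2
    rw [← eq_neg_of_add_eq_zero_right h2.symm]
    exact posSemidef_transpose_mul_mul hR _
  · calc (A + B * K)ᵀ * (P - S) + (P - S) * (A + B * K) + -E
        = ((A + B * K)ᵀ * P + P * (A + B * K) + (Q + Kᵀ * R * K)) - E -
            ((A + B * K)ᵀ * S + S * (A + B * K) + (Q + Kᵀ * R * K)) := by
          rw [Matrix.mul_sub, Matrix.sub_mul]
          abel
      _ = 0 := by rw [h1, hSeq, sub_self, sub_zero]

/-- The cost matrix of any stabilizing feedback is a supersolution, and Kleinman's iteration from it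
decreases. The limit is a priori only semidefinite; the limiting Lyapunov equation makes it
definite. -/
theorem exists_isCARESolution_of_isHurwitz {A : Matrix ι ι ℝ} {B : Matrix ι κ ℝ}
    {Q : Matrix ι ι ℝ} {R : Matrix κ κ ℝ} (hQ : Q.PosDef) (hR : R.PosDef) {K : Matrix κ ι ℝ}
    (hK : IsHurwitz (A + B * K)) : ∃ P, IsCARESolution A B Q R P := by
  let X := {P : Matrix ι ι ℝ // P.PosDef ∧
    (-(Aᵀ * P + P * A - P * B * R⁻¹ * Bᵀ * P + Q)).PosSemidef}
  have hstep : ∀ P : X, ∃ S : X, (P.1 - S.1).PosSemidef ∧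
      (A + B * feedback B R P.1)ᵀ * S.1 + S.1 * (A + B * feedback B R P.1) +
        (Q + (feedback B R P.1)ᵀ * R * feedback B R P.1) = 0 := fun P => by
    obtain ⟨S, hS, h⟩ := exists_kleinman_step A B hQ hR P.2.1 P.2.2
    exact ⟨⟨S, hS⟩, h⟩
  choose f hf using hstep
  obtain ⟨P₀, hP₀, hP₀eq⟩ :=
    hK.exists_posDef_lyapunov (posDef_add_transpose_mul_mul hQ hR K)
  have hP₀t : P₀ᵀ = P₀ := (posDef_iff_quadratic.1 hP₀).1
  have hsup₀ : (-(Aᵀ * P₀ + P₀ * A - P₀ * B * R⁻¹ * Bᵀ * P₀ + Q)).PosSemidef := by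
    have h2 := lyapunov_eq_care_add A B Q hR hP₀t K
    rw [hP₀eq] at h2
    rw [← eq_neg_of_add_eq_zero_right h2.symm]
    exact posSemidef_transpose_mul_mul hR _
  let P : ℕ → X := fun k => f^[k] ⟨P₀, hP₀, hsup₀⟩
  have hP : ∀ k, P (k + 1) = f (P k) := fun k => Function.iterate_succ_apply' f k _
  obtain ⟨L, hL, hlim⟩ := exists_tendsto_of_loewner_antitone (P := fun k => (P k).1)
    (fun k => (P k).2.1.posSemidef) (fun k => by rw [hP]; exact (hf (P k)).1)
  have hLt : Lᵀ = L := (posSemidef_iff_quadratic.1 hL).1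
  have hc : Continuous fun p : Matrix ι ι ℝ × Matrix ι ι ℝ =>
      (A + B * feedback B R p.1)ᵀ * p.2 + p.2 * (A + B * feedback B R p.1) +
        (Q + (feedback B R p.1)ᵀ * R * feedback B R p.1) := by
    unfold feedback
    fun_prop
  have hlim' : Tendsto (fun k => (P (k + 1)).1) atTop (𝓝 L) :=
    hlim.comp (tendsto_add_atTop_nat 1)
  have h1 := (hc.tendsto (L, L)).comp (hlim.prodMk_nhds hlim')
  have h2 := tendsto_nhds_unique h1 (tendsto_const_nhds.congr fun k => by
    simp only [Function.comp_apply]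
    rw [hP]
    exact (hf (P k)).2.symm)
  exact ⟨L, posDef_of_lyapunov hL (posDef_add_transpose_mul_mul hQ hR _) h2,
    (lyapunov_feedback_iff A B Q hR hLt).1 h2⟩

end Riccati

/-! ### Costs of trajectories, optimality and uniqueness -/

section Optimality

/-- The product rule, in integrated form, for primitives of integrable functions. -/
theorem integral_mul_add_mul_of_eq_primitive {f g X Y : ℝ → ℝ} {a b t : ℝ}
    (hf : IntervalIntegrable f volume 0 t) (hg : IntervalIntegrable g volume 0 t)
    (hX : ∀ s ∈ Set.uIcc 0 t, X s = a + ∫ τ in (0 : ℝ)..s, f τ)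
    (hY : ∀ s ∈ Set.uIcc 0 t, Y s = b + ∫ τ in (0 : ℝ)..s, g τ) :
    ∫ s in (0 : ℝ)..t, (f s * Y s + X s * g s) = X t * Y t - a * b := by
  have hac : ∀ {f : ℝ → ℝ} (a : ℝ), IntervalIntegrable f volume 0 t →
      AbsolutelyContinuousOnInterval (fun s => a + ∫ τ in (0 : ℝ)..s, f τ) 0 t := fun a hf =>
    ((LipschitzWith.const a).lipschitzOnWith.absolutelyContinuousOnInterval (K := 0)).add
      (hf.absolutelyContinuousOnInterval_intervalIntegral (by simp))
  have h := (hac a hf).integral_deriv_mul_eq_sub (hac b hg)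
  simp only [intervalIntegral.integral_same, add_zero] at h
  rw [hX t (by simp), hY t (by simp), ← h]
  -- The primitives are differentiable only almost everywhere, because $f$ and $g$ are merely
  -- integrable.
  refine intervalIntegral.integral_congr_ae ?_
  filter_upwards [hf.ae_hasDerivAt_integral, hg.ae_hasDerivAt_integral] with s h1 h2 hs
  have hs' : s ∈ Set.uIcc 0 t := Set.uIoc_subset_uIcc hs
  rw [hX s hs', hY s hs', ((h1 hs' 0 (by simp)).const_add a).deriv,
    ((h2 hs' 0 (by simp)).const_add b).deriv]

theorem ofReal_setIntegral_le_setLIntegral {g h : ℝ → ℝ} {t : ℝ} (ht : 0 ≤ t)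
    (hh : IntervalIntegrable h volume 0 t) (hle : ∀ s, 0 ≤ s → h s ≤ g s) :
    ENNReal.ofReal (∫ s in (0 : ℝ)..t, h s) ≤
      ∫⁻ s in Set.Ici (0 : ℝ), ENNReal.ofReal (g s) := by
  rw [intervalIntegral.integral_of_le ht,
    integral_eq_lintegral_pos_part_sub_lintegral_neg_part
      ((intervalIntegrable_iff_integrableOn_Ioc_of_le ht).1 hh)]
  calc _ ≤ ENNReal.ofReal (∫⁻ s in Set.Ioc 0 t, ENNReal.ofReal (h s)).toReal :=
        ENNReal.ofReal_le_ofReal (sub_le_self _ ENNReal.toReal_nonneg)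
    _ ≤ ∫⁻ s in Set.Ioc 0 t, ENNReal.ofReal (h s) := ENNReal.ofReal_toReal_le
    _ ≤ ∫⁻ s in Set.Ioc 0 t, ENNReal.ofReal (g s) :=
        setLIntegral_mono' measurableSet_Ioc fun s hs =>
          ENNReal.ofReal_le_ofReal (hle s hs.1.le)
    _ ≤ _ := lintegral_mono_set fun s hs => hs.1.le

/-- If the running cost `g` dominates a multiple of the storage function `V`, then a dissipation
bound `d - V t` on the total cost improves to `d`. -/
theorem ofReal_le_setLIntegral_of_storage {g V : ℝ → ℝ} {c d τ : ℝ} (hc : 0 < c)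
    (hV : ∀ t, 0 ≤ t → c * V t ≤ g t)
    (h : ∀ t, 0 ≤ t → τ ≤ t → ENNReal.ofReal (d - V t) ≤
      ∫⁻ s in Set.Ici (0 : ℝ), ENNReal.ofReal (g s)) :
    ENNReal.ofReal d ≤ ∫⁻ s in Set.Ici (0 : ℝ), ENNReal.ofReal (g s) := by
  by_contra! hlt
  set I := ∫⁻ s in Set.Ici (0 : ℝ), ENNReal.ofReal (g s) with hI
  have hfin : I ≠ ⊤ := (hlt.trans ENNReal.ofReal_lt_top).ne
  have hd : I.toReal < d := (ENNReal.lt_ofReal_iff_toReal_lt hfin).1 hlt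
  -- If the cost $I$ were below $d$, the bound would keep $V\ge d-I>0$ from time $\tau$ on, so $g$
  -- would stay above a positive constant and the cost would be infinite. No decay of $V$ has to be
  -- known.
  have hlow : ∀ t ∈ Set.Ici (max 0 τ), c * (d - I.toReal) ≤ g t := fun t ht => by
    have ht' : 0 ≤ t ∧ τ ≤ t := max_le_iff.1 ht
    have h1 := (ENNReal.ofReal_le_iff_le_toReal hfin).1 (h t ht'.1 ht'.2)
    exact le_trans (by gcongr; linarith) (hV t ht'.1)
  refine hfin (top_unique ?_)
  calc (⊤ : ENNReal)
      = ∫⁻ _ in Set.Ici (max 0 τ), ENNReal.ofReal (c * (d - I.toReal)) := by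
        rw [setLIntegral_const, Real.volume_Ici, ENNReal.mul_top]
        exact (ENNReal.ofReal_pos.2 (mul_pos hc (sub_pos.2 hd))).ne'
    _ ≤ ∫⁻ s in Set.Ici (max 0 τ), ENNReal.ofReal (g s) :=
        setLIntegral_mono' measurableSet_Ici fun s hs => ENNReal.ofReal_le_ofReal (hlow s hs)
    _ ≤ I := lintegral_mono_set (Set.Ici_subset_Ici.2 (le_max_left _ _))

variable {ι κ : Type*} [Fintype ι] [Fintype κ]

theorem IsTrajectory.dynamics_intervalIntegrable {A : Matrix ι ι ℝ} {B : Matrix ι κ ℝ}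
    {x₀ : ι → ℝ} {u : ℝ → κ → ℝ} {x : ℝ → ι → ℝ} (h : IsTrajectory A B x₀ u x) {t : ℝ}
    (ht : 0 ≤ t) : IntervalIntegrable (fun s => A *ᵥ x s + B *ᵥ u s) volume 0 t := by
  have hx : ContinuousOn (fun s => A *ᵥ x s) (Set.uIcc 0 t) := by
    have h1 : ContinuousOn x (Set.uIcc 0 t) :=
      h.state_continuous.mono (by rw [Set.uIcc_of_le ht]; exact Set.Icc_subset_Ici_self)
    have hA : Continuous fun v : ι → ℝ => A *ᵥ v := by fun_prop
    exact hA.comp_continuousOn h1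
  have hu : IntervalIntegrable (fun s => B *ᵥ u s) volume 0 t := by
    have h1 := h.control_integrable t ht
    exact ⟨(LinearMap.toContinuousLinearMap B.mulVecLin).integrable_comp h1.1,
      (LinearMap.toContinuousLinearMap B.mulVecLin).integrable_comp h1.2⟩
  exact hx.intervalIntegrable.add hu

theorem IsTrajectory.integral_quadratic {A : Matrix ι ι ℝ} {B : Matrix ι κ ℝ} {x₀ : ι → ℝ}
    {u : ℝ → κ → ℝ} {x : ℝ → ι → ℝ} (h : IsTrajectory A B x₀ u x) (P : Matrix ι ι ℝ) {t : ℝ}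
    (ht : 0 ≤ t) :
    IntervalIntegrable (fun s => (A *ᵥ x s + B *ᵥ u s) ⬝ᵥ (P *ᵥ x s) +
        x s ⬝ᵥ (P *ᵥ (A *ᵥ x s + B *ᵥ u s))) volume 0 t ∧
      ∫ s in (0 : ℝ)..t, ((A *ᵥ x s + B *ᵥ u s) ⬝ᵥ (P *ᵥ x s) +
        x s ⬝ᵥ (P *ᵥ (A *ᵥ x s + B *ᵥ u s))) = x t ⬝ᵥ (P *ᵥ x t) - x₀ ⬝ᵥ (P *ᵥ x₀) := by
  set f : ℝ → ι → ℝ := fun s => A *ᵥ x s + B *ᵥ u s with hf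
  have hfi := h.dynamics_intervalIntegrable ht
  have hfc : ∀ i, IntervalIntegrable (fun s => f s i) volume 0 t := fun i =>
    ⟨(ContinuousLinearMap.proj (R := ℝ) (φ := fun _ : ι => ℝ) i).integrable_comp hfi.1,
      (ContinuousLinearMap.proj (R := ℝ) (φ := fun _ : ι => ℝ) i).integrable_comp hfi.2⟩
  have hxc : ∀ i, ∀ s ∈ Set.uIcc 0 t, x s i = x₀ i + ∫ τ in (0 : ℝ)..s, f τ i := by
    intro i s hs
    rw [Set.uIcc_of_le ht] at hs
    rw [h.state_eq s hs.1, Pi.add_apply]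
    congr 1
    exact ((ContinuousLinearMap.proj (R := ℝ) (φ := fun _ : ι => ℝ) i).intervalIntegral_comp_comm
      (h.dynamics_intervalIntegrable hs.1)).symm
  have hxcont : ∀ i, ContinuousOn (fun s => x s i) (Set.uIcc 0 t) := fun i =>
    ((continuous_apply i).comp_continuousOn h.state_continuous).mono
      (by rw [Set.uIcc_of_le ht]; exact Set.Icc_subset_Ici_self)
  have hint : ∀ i j, IntervalIntegrable (fun s => f s i * x s j + x s i * f s j) volume 0 t :=
    fun i j => ((hfc i).mul_continuousOn (hxcont j)).add ((hfc j).continuousOn_mul (hxcont i))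
  have hexp : (fun s => f s ⬝ᵥ (P *ᵥ x s) + x s ⬝ᵥ (P *ᵥ f s)) =
      fun s => ∑ i, ∑ j, P i j * (f s i * x s j + x s i * f s j) := by
    funext s
    simp only [dotProduct, Matrix.mulVec, Finset.mul_sum, ← Finset.sum_add_distrib]
    exact Finset.sum_congr rfl fun i _ => Finset.sum_congr rfl fun j _ => by ring
  have hi : ∀ i, IntervalIntegrable
      (fun s => ∑ j, P i j * (f s i * x s j + x s i * f s j)) volume 0 t := fun i => by
    simpa [Finset.sum_fn] using
      IntervalIntegrable.sum Finset.univ (fun j _ => (hint i j).const_mul (P i j))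
  rw [hexp]
  refine ⟨by simpa [Finset.sum_fn] using IntervalIntegrable.sum Finset.univ fun i _ => hi i, ?_⟩
  rw [intervalIntegral.integral_finsetSum fun i _ => hi i]
  simp only [dotProduct, Matrix.mulVec, Finset.mul_sum, ← Finset.sum_sub_distrib]
  refine Finset.sum_congr rfl fun i _ => ?_
  rw [intervalIntegral.integral_finsetSum fun j _ => (hint i j).const_mul (P i j)]
  refine Finset.sum_congr rfl fun j _ => ?_
  rw [intervalIntegral.integral_const_mul,
    integral_mul_add_mul_of_eq_primitive (hfc i) (hfc j) (hxc i) (hxc j)]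
  ring

theorem continuous_closedLoop [DecidableEq ι] (A : Matrix ι ι ℝ) (B : Matrix ι κ ℝ) (F : Matrix κ ι ℝ)
    (x₀ : ι → ℝ) : Continuous (closedLoop A B F x₀) :=
  continuous_iff_continuousAt.2 fun t => (hasDerivAt_exp_mulVec (A + B * F) x₀ t).continuousAt

theorem closedLoop_zero [DecidableEq ι] (A : Matrix ι ι ℝ) (B : Matrix ι κ ℝ) (F : Matrix κ ι ℝ)
    (x₀ : ι → ℝ) : closedLoop A B F x₀ 0 = x₀ :=
  exp_zero_smul_mulVec _ _

/-- The closed loop of one system is a trajectory of every system with the same closed-loop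
matrix. -/
theorem isTrajectory_closedLoop [DecidableEq ι] {κ' : Type*} [Fintype κ'] {A A' : Matrix ι ι ℝ}
    {B : Matrix ι κ ℝ} {F : Matrix κ ι ℝ} {B' : Matrix ι κ' ℝ} {F' : Matrix κ' ι ℝ}
    (h : A' + B' * F' = A + B * F) (x₀ : ι → ℝ) :
    IsTrajectory A' B' x₀ (fun t => F' *ᵥ closedLoop A B F x₀ t) (closedLoop A B F x₀) := by
  have hc := continuous_closedLoop A B F x₀
  refine ⟨fun t _ => Continuous.intervalIntegrable (by fun_prop) _ _, hc.continuousOn,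
    fun t _ => ?_⟩
  have h1 : ∀ s, A' *ᵥ closedLoop A B F x₀ s + B' *ᵥ (F' *ᵥ closedLoop A B F x₀ s) =
      (A + B * F) *ᵥ closedLoop A B F x₀ s := fun s => by
    rw [Matrix.mulVec_mulVec, ← Matrix.add_mulVec, h]
  have h2 : ∀ s, HasDerivAt (closedLoop A B F x₀) ((A + B * F) *ᵥ closedLoop A B F x₀ s) s :=
    hasDerivAt_exp_mulVec (A + B * F) x₀
  simp only [h1]
  rw [intervalIntegral.integral_eq_sub_of_hasDerivAt (fun s _ => h2 s)
    (Continuous.intervalIntegrable (by fun_prop) _ _), closedLoop_zero]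
  exact (add_sub_cancel x₀ _).symm

/-- Along the closed loop the running cost is $-\frac{d}{dt}x^{\mathsf T}Px$, and stability kills
the boundary term at infinity. -/
theorem value_eq_of_lyapunov [DecidableEq ι] {A : Matrix ι ι ℝ} {B : Matrix ι κ ℝ}
    {Q : Matrix ι ι ℝ} {R : Matrix κ κ ℝ} {F : Matrix κ ι ℝ} {P : Matrix ι ι ℝ}
    (hQ : Q.PosDef) (hR : R.PosDef) (hP : P.PosDef)
    (h : (A + B * F)ᵀ * P + P * (A + B * F) + (Q + Fᵀ * R * F) = 0)
    (x : ι → ℝ) : value A B Q R F x = ENNReal.ofReal (x ⬝ᵥ (P *ᵥ x)) := by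
  have hM := posDef_add_transpose_mul_mul hQ hR F
  have hM0 := (posSemidef_iff_quadratic.1 hM.posSemidef).2
  have hH := isHurwitz_of_lyapunov hP hM h
  set φ := closedLoop A B F x with hφ
  have hd : ∀ t, HasDerivAt (fun s => φ s ⬝ᵥ (P *ᵥ φ s))
      (-(φ t ⬝ᵥ ((Q + Fᵀ * R * F) *ᵥ φ t))) t := fun t => by
    have h1 := hasDerivAt_bilin_exp (A + B * F) P x x t
    rwa [eq_neg_of_add_eq_zero_left h, Matrix.neg_mulVec, dotProduct_neg] at h1
  have hneg : ∀ t ∈ Set.Ioi (0 : ℝ), -(φ t ⬝ᵥ ((Q + Fᵀ * R * F) *ᵥ φ t)) ≤ 0 := fun t _ =>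
    neg_nonpos.2 (hM0 _)
  have hlim := hH.tendsto_quadratic P x
  have h1 := integral_Ioi_of_hasDerivAt_of_nonpos' (fun t _ => hd t) hneg hlim
  have h2 := integrableOn_Ioi_deriv_of_nonpos' (fun t _ => hd t) hneg hlim
  have h3 : IntegrableOn (fun t => φ t ⬝ᵥ ((Q + Fᵀ * R * F) *ᵥ φ t)) (Set.Ioi 0) := by
    simpa using h2.neg
  rw [integral_neg, zero_sub, neg_inj, hφ, closedLoop_zero, ← hφ] at h1
  rw [value, cost, ← setLIntegral_congr Ioi_ae_eq_Ici, ← h1,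
    ofReal_integral_eq_lintegral_ofReal h3 (Eventually.of_forall fun t => hM0 _)]
  refine lintegral_congr fun t => ?_
  rw [Matrix.add_mulVec, dotProduct_add, ← Matrix.mulVec_mulVec, ← Matrix.mulVec_mulVec,
    Matrix.dotProduct_mulVec _ Fᵀ, Matrix.vecMul_transpose]

theorem dotProduct_mulVec_comm_of_transpose_eq {M : Matrix ι ι ℝ} (hM : Mᵀ = M) (y z : ι → ℝ) :
    y ⬝ᵥ (M *ᵥ z) = z ⬝ᵥ (M *ᵥ y) := by
  rw [Matrix.dotProduct_mulVec, ← Matrix.mulVec_transpose, hM, dotProduct_comm]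

variable [DecidableEq κ]

/-- Completion of squares along a trajectory. -/
theorem IsCARESolution.running_cost_eq {A : Matrix ι ι ℝ} {B : Matrix ι κ ℝ} {Q : Matrix ι ι ℝ}
    {R : Matrix κ κ ℝ} {P : Matrix ι ι ℝ} (hR : R.PosDef) (h : IsCARESolution A B Q R P)
    (x : ι → ℝ) (u : κ → ℝ) :
    x ⬝ᵥ (Q *ᵥ x) + u ⬝ᵥ (R *ᵥ u) =
      -((A *ᵥ x + B *ᵥ u) ⬝ᵥ (P *ᵥ x) + x ⬝ᵥ (P *ᵥ (A *ᵥ x + B *ᵥ u))) +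
        (u - feedback B R P *ᵥ x) ⬝ᵥ (R *ᵥ (u - feedback B R P *ᵥ x)) := by
  have hPt := (posDef_iff_quadratic.1 h.1).1
  have hL := (lyapunov_feedback_iff A B Q hR hPt).2 h.2
  set K := feedback B R P with hK
  have hRK : R * K = -(Bᵀ * P) := mul_feedback B hR P
  have hRt : Rᵀ = R := (posDef_iff_quadratic.1 hR).1
  -- In the variable $v=u-Kx$ the cross terms cancel, since $RK=-B^{\mathsf T}P$.
  obtain ⟨v, rfl⟩ : ∃ v, u = v + K *ᵥ x := ⟨u - K *ᵥ x, by simp⟩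
  have h1 : A *ᵥ x + B *ᵥ (v + K *ᵥ x) = (A + B * K) *ᵥ x + B *ᵥ v := by
    rw [Matrix.mulVec_add, Matrix.add_mulVec, Matrix.mulVec_mulVec]
    abel
  have h2 := dotProduct_lyapunov (A + B * K) P x x
  rw [eq_neg_of_add_eq_zero_left hL, Matrix.neg_mulVec, dotProduct_neg,
    Matrix.add_mulVec Q, dotProduct_add] at h2
  have h3 : x ⬝ᵥ ((Kᵀ * R * K) *ᵥ x) = (K *ᵥ x) ⬝ᵥ (R *ᵥ (K *ᵥ x)) := by
    rw [← Matrix.mulVec_mulVec, ← Matrix.mulVec_mulVec, Matrix.dotProduct_mulVec x Kᵀ,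
      Matrix.vecMul_transpose]
  have h4 : v ⬝ᵥ (R *ᵥ (K *ᵥ x)) = -((B *ᵥ v) ⬝ᵥ (P *ᵥ x)) := by
    rw [Matrix.mulVec_mulVec, hRK, Matrix.neg_mulVec, dotProduct_neg, ← Matrix.mulVec_mulVec,
      Matrix.dotProduct_mulVec v Bᵀ, Matrix.vecMul_transpose]
  have h5 := dotProduct_mulVec_comm_of_transpose_eq hRt (K *ᵥ x) v
  have h6 := dotProduct_mulVec_comm_of_transpose_eq hPt x (B *ᵥ v)
  rw [h1, add_sub_cancel_right]
  simp only [Matrix.mulVec_add, dotProduct_add, add_dotProduct] at h2 ⊢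
  linarith

/-- A Riccati solution bounds the cost of every trajectory from below. -/
theorem IsCARESolution.ofReal_le_cost {A : Matrix ι ι ℝ} {B : Matrix ι κ ℝ} {Q : Matrix ι ι ℝ}
    {R : Matrix κ κ ℝ} {P : Matrix ι ι ℝ} (hQ : Q.PosDef) (hR : R.PosDef)
    (h : IsCARESolution A B Q R P) {x₀ : ι → ℝ} {u : ℝ → κ → ℝ} {x : ℝ → ι → ℝ}
    (hx : IsTrajectory A B x₀ u x) : ENNReal.ofReal (x₀ ⬝ᵥ (P *ᵥ x₀)) ≤ cost Q R u x := by
  obtain ⟨c, hc, hcQ⟩ := exists_smul_quadratic_le hQ P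
  have hR0 := (posSemidef_iff_quadratic.1 hR.posSemidef).2
  refine ofReal_le_setLIntegral_of_storage (V := fun t => x t ⬝ᵥ (P *ᵥ x t)) (τ := 0) hc
    (fun t _ => (hcQ (x t)).trans (le_add_of_nonneg_right (hR0 _))) fun t ht _ => ?_
  obtain ⟨h1, h2⟩ := hx.integral_quadratic P ht
  have h3 := ofReal_setIntegral_le_setLIntegral
    (g := fun t => x t ⬝ᵥ (Q *ᵥ x t) + u t ⬝ᵥ (R *ᵥ u t)) ht h1.neg fun s _ => by
      rw [h.running_cost_eq hR]
      exact le_add_of_nonneg_right (hR0 _)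
  simp only [Pi.neg_apply] at h3
  rwa [intervalIntegral.integral_neg, h2, neg_sub] at h3

variable [DecidableEq ι]

theorem IsCARESolution.value_feedback {A : Matrix ι ι ℝ} {B : Matrix ι κ ℝ} {Q : Matrix ι ι ℝ}
    {R : Matrix κ κ ℝ} {P : Matrix ι ι ℝ} (hQ : Q.PosDef) (hR : R.PosDef)
    (h : IsCARESolution A B Q R P) (x : ι → ℝ) :
    value A B Q R (feedback B R P) x = ENNReal.ofReal (x ⬝ᵥ (P *ᵥ x)) :=
  value_eq_of_lyapunov hQ hR h.1
    ((lyapunov_feedback_iff A B Q hR (posDef_iff_quadratic.1 h.1).1).2 h.2) x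

theorem IsCARESolution.isOptimalFeedback {A : Matrix ι ι ℝ} {B : Matrix ι κ ℝ}
    {Q : Matrix ι ι ℝ} {R : Matrix κ κ ℝ} {P : Matrix ι ι ℝ} (hQ : Q.PosDef) (hR : R.PosDef)
    (h : IsCARESolution A B Q R P) : IsOptimalFeedback A B Q R (feedback B R P) :=
  fun x₀ _ _ hx => (h.value_feedback hQ hR x₀).le.trans (h.ofReal_le_cost hQ hR hx)

/-- The closed loop of the feedback from $S$ costs exactly $x^{\mathsf T}Sx$, and $P$ bounds the
cost of every trajectory from below. Exchanging the roles yields uniqueness. -/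
theorem IsCARESolution.quadratic_le {A : Matrix ι ι ℝ} {B : Matrix ι κ ℝ}
    {Q : Matrix ι ι ℝ} {R : Matrix κ κ ℝ} {P S : Matrix ι ι ℝ} (hQ : Q.PosDef) (hR : R.PosDef)
    (hP : IsCARESolution A B Q R P) (hS : IsCARESolution A B Q R S) (x : ι → ℝ) :
    x ⬝ᵥ (P *ᵥ x) ≤ x ⬝ᵥ (S *ᵥ x) := by
  have h1 := (hP.ofReal_le_cost hQ hR (isTrajectory_closedLoop rfl x)).trans_eq
    (hS.value_feedback hQ hR x)
  exact (ENNReal.ofReal_le_ofReal_iff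
    ((posSemidef_iff_quadratic.1 hS.1.posSemidef).2 x)).1 h1

theorem IsCARESolution.unique {A : Matrix ι ι ℝ} {B : Matrix ι κ ℝ}
    {Q : Matrix ι ι ℝ} {R : Matrix κ κ ℝ} {P S : Matrix ι ι ℝ} (hQ : Q.PosDef) (hR : R.PosDef)
    (hP : IsCARESolution A B Q R P) (hS : IsCARESolution A B Q R S) : P = S :=
  eq_of_quadratic_eq (posDef_iff_quadratic.1 hP.1).1 (posDef_iff_quadratic.1 hS.1).1 fun x =>
    (hP.quadratic_le hQ hR hS x).antisymm (hS.quadratic_le hQ hR hP x)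

/-- Where $F$ and $K$ differ on $x_0$, the completed square adds a positive amount to the cost
already on $[0,1]$, so $F$ costs strictly more than $K$. Stability of $F$ is not presupposed. -/
theorem IsOptimalFeedback.eq_feedback {A : Matrix ι ι ℝ} {B : Matrix ι κ ℝ}
    {Q : Matrix ι ι ℝ} {R : Matrix κ κ ℝ} {P : Matrix ι ι ℝ} {F : Matrix κ ι ℝ} (hQ : Q.PosDef)
    (hR : R.PosDef) (hP : IsCARESolution A B Q R P) (hF : IsOptimalFeedback A B Q R F) :
    F = feedback B R P := by
  refine sub_eq_zero.1 (Matrix.mulVec_injective (funext fun x₀ => ?_))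
  rw [Matrix.zero_mulVec]
  by_contra hne
  set K := feedback B R P with hK
  set φ := closedLoop A B F x₀ with hφ
  have hφc : Continuous φ := continuous_closedLoop A B F x₀
  set w : ℝ → ℝ := fun t => ((F - K) *ᵥ φ t) ⬝ᵥ (R *ᵥ ((F - K) *ᵥ φ t)) with hw
  have hwc : Continuous w := (continuous_quadratic R).comp (by fun_prop)
  have hR0 := (posSemidef_iff_quadratic.1 hR.posSemidef).2
  have hw0 : ∀ t, 0 ≤ w t := fun t => hR0 _
  have hwpos : 0 < ∫ s in (0 : ℝ)..1, w s := by
    refine intervalIntegral.integral_pos one_pos hwc.continuousOn (fun s _ => hw0 s)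
      ⟨0, by simp, ?_⟩
    rw [hw, hφ]
    simp only [closedLoop_zero]
    exact (posDef_iff_quadratic.1 hR).2 _ hne
  have htraj : IsTrajectory A B x₀ (fun t => F *ᵥ φ t) φ := isTrajectory_closedLoop rfl x₀
  obtain ⟨c, hc, hcQ⟩ := exists_smul_quadratic_le hQ P
  have hlow : ENNReal.ofReal (x₀ ⬝ᵥ (P *ᵥ x₀) + ∫ s in (0 : ℝ)..1, w s) ≤
      value A B Q R F x₀ := by
    -- The choice $\tau=1$ is due to the excess: it is collected in full only from time $1$ on.
    refine ofReal_le_setLIntegral_of_storage (V := fun t => φ t ⬝ᵥ (P *ᵥ φ t)) (τ := 1) hc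
      (fun t _ => (hcQ (φ t)).trans (le_add_of_nonneg_right (hR0 _))) fun t ht ht1 => ?_
    obtain ⟨h1, h2⟩ := htraj.integral_quadratic P ht
    have h3 := ofReal_setIntegral_le_setLIntegral
      (g := fun t => φ t ⬝ᵥ (Q *ᵥ φ t) + (F *ᵥ φ t) ⬝ᵥ (R *ᵥ (F *ᵥ φ t))) ht
      (h1.neg.add (hwc.intervalIntegrable 0 t)) fun s _ => by
        rw [hP.running_cost_eq hR, ← Matrix.sub_mulVec]
        exact le_rfl
    refine le_trans (ENNReal.ofReal_le_ofReal ?_) h3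
    rw [intervalIntegral.integral_add h1.neg (hwc.intervalIntegrable 0 t)]
    simp only [Pi.neg_apply]
    rw [intervalIntegral.integral_neg, h2,
      ← intervalIntegral.integral_add_adjacent_intervals (hwc.intervalIntegrable 0 1)
        (hwc.intervalIntegrable 1 t)]
    have := intervalIntegral.integral_nonneg (μ := volume) ht1 fun s _ => hw0 s
    linarith
  have hle := hlow.trans (hF x₀ _ _ (isTrajectory_closedLoop (A := A) (B := B) (F := K) rfl x₀))
  have hPx := (posSemidef_iff_quadratic.1 hP.1.posSemidef).2 x₀
  have h4 := hle.trans_eq (hP.value_feedback hQ hR x₀)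
  rw [ENNReal.ofReal_le_ofReal_iff hPx] at h4
  linarith

theorem IsCARESolution.isOptimalFeedback_iff {A : Matrix ι ι ℝ} {B : Matrix ι κ ℝ}
    {Q : Matrix ι ι ℝ} {R : Matrix κ κ ℝ} {P : Matrix ι ι ℝ} {F : Matrix κ ι ℝ} (hQ : Q.PosDef)
    (hR : R.PosDef) (hP : IsCARESolution A B Q R P) :
    IsOptimalFeedback A B Q R F ↔ F = feedback B R P :=
  ⟨fun h => h.eq_feedback hQ hR hP, fun h => h ▸ hP.isOptimalFeedback hQ hR⟩

end Optimality

/-! ### Block algebra of the subsystem decomposition -/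

section Split

variable {m n : ℕ} {r : Fin n → ℕ}

theorem transpose_blockCol_mul_apply (i : Fin n) (F : Matrix (Inputs r) (Fin m) ℝ) (a : Fin (r i))
    (b : Fin m) : ((blockCol r i)ᵀ * F) a b = F ⟨i, a⟩ b := by
  simp [Matrix.mul_apply, blockCol]

theorem eq_of_transpose_blockCol_mul_eq {F G : Matrix (Inputs r) (Fin m) ℝ}
    (h : ∀ i, (blockCol r i)ᵀ * F = (blockCol r i)ᵀ * G) : F = G := by
  ext ⟨i, a⟩ b
  have h1 := congrFun (congrFun (h i) a) b
  rwa [transpose_blockCol_mul_apply, transpose_blockCol_mul_apply] at h1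

theorem transpose_blockCol_mul_blockCol (i : Fin n) : (blockCol r i)ᵀ * blockCol r i = 1 := by
  ext a b
  simp [Matrix.mul_apply, blockCol, Matrix.one_apply, eq_comm]

theorem coProj_mul_blockCol (i : Fin n) : coProj r i * blockCol r i = 0 := by
  rw [coProj, Matrix.sub_mul, Matrix.mul_assoc, transpose_blockCol_mul_blockCol]
  simp

theorem transpose_coProj (i : Fin n) : (coProj r i)ᵀ = coProj r i := by
  simp [coProj]

theorem transpose_blockCol_mul_coProj (i : Fin n) : (blockCol r i)ᵀ * coProj r i = 0 := by
  have h := congrArg Matrix.transpose (coProj_mul_blockCol (r := r) i)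
  rwa [Matrix.transpose_mul, transpose_coProj, Matrix.transpose_zero] at h

theorem coProj_add (i : Fin n) : coProj r i + blockCol r i * (blockCol r i)ᵀ = 1 := by
  simp [coProj]

theorem coProj_mul_self (i : Fin n) : coProj r i * coProj r i = coProj r i := by
  nth_rw 2 [coProj]
  rw [Matrix.mul_sub, Matrix.mul_one, ← Matrix.mul_assoc, coProj_mul_blockCol]
  simp

theorem coProj_mul_add (i : Fin n) (F : Matrix (Inputs r) (Fin m) ℝ) :
    coProj r i * F + blockCol r i * ((blockCol r i)ᵀ * F) = F := by
  rw [← Matrix.mul_assoc, ← Matrix.add_mul, coProj_add, Matrix.one_mul]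

theorem transpose_blockCol_mul_of_coProj_mul_eq {i j : Fin n} (hij : i ≠ j)
    {F G : Matrix (Inputs r) (Fin m) ℝ} (h : coProj r i * F = coProj r i * G) :
    (blockCol r j)ᵀ * F = (blockCol r j)ᵀ * G := by
  have h0 : (blockCol r j)ᵀ * blockCol r i = 0 := by
    ext a b
    simp [Matrix.mul_apply, blockCol, hij]
  have h1 : ∀ F : Matrix (Inputs r) (Fin m) ℝ,
      (blockCol r j)ᵀ * F = (blockCol r j)ᵀ * (coProj r i * F) := fun F => by
    conv_lhs => rw [← coProj_mul_add i F]
    rw [Matrix.mul_add, ← Matrix.mul_assoc _ (blockCol r i), h0, Matrix.zero_mul, add_zero]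
  rw [h1, h, ← h1]

theorem IsBlockDiag.transpose_blockCol_mul_mul_coProj {R : Matrix (Inputs r) (Inputs r) ℝ}
    (h : IsBlockDiag R) (i : Fin n) : (blockCol r i)ᵀ * R * coProj r i = 0 := by
  ext a p
  obtain ⟨j, b⟩ := p
  have h1 : ∀ q, ((blockCol r i)ᵀ * R) a q = R ⟨i, a⟩ q := fun q => by
    simp [Matrix.mul_apply, blockCol]
  rw [coProj, Matrix.mul_sub, Matrix.mul_one, ← Matrix.mul_assoc, Matrix.sub_apply, h1,
    Matrix.mul_apply, Matrix.zero_apply]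
  have h2 : ∀ c, (((blockCol r i)ᵀ * R) * blockCol r i) a c = R ⟨i, a⟩ ⟨i, c⟩ := fun c => by
    rw [Matrix.mul_apply]
    simp only [h1]
    simp [blockCol]
  simp only [h2]
  simp only [Matrix.transpose_apply, blockCol, Matrix.of_apply]
  by_cases hij : i = j
  · subst hij
    simp
  · rw [h ⟨i, a⟩ ⟨j, b⟩ hij, Finset.sum_eq_zero fun c _ => ?_, sub_zero]
    rw [if_neg fun hc => hij (congrArg Sigma.fst hc).symm, mul_zero]

theorem IsBlockDiag.coProj_mul_mul_blockCol {R : Matrix (Inputs r) (Inputs r) ℝ}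
    (h : IsBlockDiag R) (hR : Rᵀ = R) (i : Fin n) : coProj r i * R * blockCol r i = 0 := by
  have h1 := congrArg Matrix.transpose (h.transpose_blockCol_mul_mul_coProj i)
  rwa [Matrix.transpose_mul, Matrix.transpose_mul, transpose_coProj, hR,
    Matrix.transpose_transpose, Matrix.transpose_zero, ← Matrix.mul_assoc] at h1

theorem IsBlockDiag.eq_coProj_add {R : Matrix (Inputs r) (Inputs r) ℝ}
    (h : IsBlockDiag R) (hR : Rᵀ = R) (i : Fin n) :
    R = coProj r i * R * coProj r i + blockCol r i * subR R i * (blockCol r i)ᵀ := by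
  have h1 := h.transpose_blockCol_mul_mul_coProj i
  have h2 := h.coProj_mul_mul_blockCol hR i
  calc R = (coProj r i + blockCol r i * (blockCol r i)ᵀ) * R *
        (coProj r i + blockCol r i * (blockCol r i)ᵀ) := by
        rw [coProj_add, Matrix.one_mul, Matrix.mul_one]
    _ = coProj r i * R * coProj r i + blockCol r i * ((blockCol r i)ᵀ * R * coProj r i) +
          (coProj r i * R * blockCol r i) * (blockCol r i)ᵀ +
          blockCol r i * subR R i * (blockCol r i)ᵀ := by
        simp only [subR, Matrix.mul_add, Matrix.add_mul, Matrix.mul_assoc]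
        abel
    _ = _ := by rw [h1, h2]; simp

theorem posDef_subR {R : Matrix (Inputs r) (Inputs r) ℝ} (hR : R.PosDef) (i : Fin n) :
    (subR R i).PosDef := by
  have h1 := hR.conjTranspose_mul_mul_same (B := blockCol r i) fun x y hxy => by
    have h2 := congrArg ((blockCol r i)ᵀ *ᵥ ·) hxy
    simpa [Matrix.mulVec_mulVec, transpose_blockCol_mul_blockCol] using h2
  rwa [Matrix.conjTranspose_eq_transpose_of_trivial] at h1

theorem posDef_subQ {Q : Matrix (Fin m) (Fin m) ℝ} {R : Matrix (Inputs r) (Inputs r) ℝ}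
    (hQ : Q.PosDef) (hR : R.PosDef) (i : Fin n) (F : Matrix (Inputs r) (Fin m) ℝ) :
    (subQ Q R i F).PosDef := by
  have h1 := posDef_add_transpose_mul_mul hQ hR (coProj r i * F)
  rwa [Matrix.transpose_mul, transpose_coProj, ← Matrix.mul_assoc] at h1

theorem subA_add_subB_mul (A : Matrix (Fin m) (Fin m) ℝ) (B : Matrix (Fin m) (Inputs r) ℝ)
    {i : Fin n} {F G : Matrix (Inputs r) (Fin m) ℝ} (h : coProj r i * G = coProj r i * F) :
    subA A B i F + subB B i * ((blockCol r i)ᵀ * G) = A + B * G := by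
  conv_rhs => rw [← coProj_mul_add i G]
  rw [subA, subB, Matrix.mul_add, Matrix.mul_assoc, ← h, Matrix.mul_assoc B (blockCol r i),
    add_assoc]

/-- Block diagonality of $R$ removes the cross terms between block $i$ and the rest; with
`subA_add_subB_mul` this identifies the subproblem with the full problem. -/
theorem subQ_add_subR (Q : Matrix (Fin m) (Fin m) ℝ) {R : Matrix (Inputs r) (Inputs r) ℝ}
    (hRt : Rᵀ = R) (hRb : IsBlockDiag R) {i : Fin n} {F G : Matrix (Inputs r) (Fin m) ℝ}
    (h : coProj r i * G = coProj r i * F) :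
    subQ Q R i F + ((blockCol r i)ᵀ * G)ᵀ * subR R i * ((blockCol r i)ᵀ * G) =
      Q + Gᵀ * R * G := by
  have h1 : Fᵀ * coProj r i = Gᵀ * coProj r i := by
    have := congrArg Matrix.transpose h
    rw [Matrix.transpose_mul, Matrix.transpose_mul, transpose_coProj] at this
    exact this.symm
  conv_rhs => rw [hRb.eq_coProj_add hRt i]
  rw [subQ, h1, Matrix.mul_assoc _ (coProj r i) F, ← h]
  simp only [Matrix.mul_add, Matrix.add_mul, Matrix.transpose_mul, Matrix.transpose_transpose,
    Matrix.mul_assoc, add_assoc]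

/-! ### A single update -/

section Step

variable {A : Matrix (Fin m) (Fin m) ℝ} {B : Matrix (Fin m) (Inputs r) ℝ}
  {Q : Matrix (Fin m) (Fin m) ℝ} {R : Matrix (Inputs r) (Inputs r) ℝ} {i : Fin n}
  {F Fnew : Matrix (Inputs r) (Fin m) ℝ} {P : Matrix (Fin m) (Fin m) ℝ}

/-- A block-diagonal $R$ is inverted block by block. This is how updates made separately assemble to
the feedback of the full problem once their Riccati solutions agree. -/
theorem transpose_blockCol_mul_feedback (B : Matrix (Fin m) (Inputs r) ℝ) (hR : R.PosDef)
    (hRb : IsBlockDiag R) (i : Fin n) (P : Matrix (Fin m) (Fin m) ℝ) :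
    (blockCol r i)ᵀ * feedback B R P = feedback (subB B i) (subR R i) P := by
  have hu : IsUnit (subR R i).det :=
    (Matrix.isUnit_iff_isUnit_det _).1 (posDef_subR hR i).isUnit
  have h1 : subR R i * ((blockCol r i)ᵀ * feedback B R P) = -((subB B i)ᵀ * P) := by
    calc subR R i * ((blockCol r i)ᵀ * feedback B R P)
        = (blockCol r i)ᵀ * R * coProj r i * feedback B R P +
            (blockCol r i)ᵀ * R * (blockCol r i * ((blockCol r i)ᵀ * feedback B R P)) := by
          rw [hRb.transpose_blockCol_mul_mul_coProj, Matrix.zero_mul, zero_add, subR]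
          simp only [Matrix.mul_assoc]
      _ = (blockCol r i)ᵀ * (R * feedback B R P) := by
          rw [Matrix.mul_assoc _ (coProj r i), ← Matrix.mul_add, coProj_mul_add, Matrix.mul_assoc]
      _ = _ := by
          rw [mul_feedback B hR, subB, Matrix.transpose_mul, Matrix.mul_neg, Matrix.mul_assoc]
  rw [← Matrix.nonsing_inv_mul_cancel_left _ ((blockCol r i)ᵀ * feedback B R P) hu, h1, feedback,
    Matrix.mul_neg, Matrix.mul_assoc]

/-- The Riccati equation of a subproblem is the Lyapunov equation of the updated feedback. -/
theorem IsSplitStep.lyapunov (hR : R.PosDef) (hRb : IsBlockDiag R)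
    (h : IsSplitStep A B Q R i F P Fnew) :
    (A + B * Fnew)ᵀ * P + P * (A + B * Fnew) + (Q + Fnewᵀ * R * Fnew) = 0 := by
  have h1 := (lyapunov_feedback_iff (subA A B i F) (subB B i) (subQ Q R i F) (posDef_subR hR i)
    (posDef_iff_quadratic.1 h.care.1).1).2 h.care.2
  rwa [← h.updated, subA_add_subB_mul A B h.unchanged,
    subQ_add_subR Q (posDef_iff_quadratic.1 hR).1 hRb h.unchanged] at h1

theorem IsSplitStep.isHurwitz (hQ : Q.PosDef) (hR : R.PosDef) (hRb : IsBlockDiag R)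
    (h : IsSplitStep A B Q R i F P Fnew) : IsHurwitz (A + B * Fnew) :=
  isHurwitz_of_lyapunov h.care.1 (posDef_add_transpose_mul_mul hQ hR Fnew) (h.lyapunov hR hRb)

theorem IsSplitStep.value_eq (hQ : Q.PosDef) (hR : R.PosDef) (hRb : IsBlockDiag R)
    (h : IsSplitStep A B Q R i F P Fnew) (x : Fin m → ℝ) :
    value A B Q R Fnew x = ENNReal.ofReal (x ⬝ᵥ (P *ᵥ x)) :=
  value_eq_of_lyapunov hQ hR h.care.1 (h.lyapunov hR hRb) x

/-- The closed loop of the old $F$ is a trajectory of the subproblem with equal cost, so the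
subproblem's Riccati bound applies, even if $F$ is not stabilizing and its cost is infinite. -/
theorem IsSplitStep.ofReal_le_value (hQ : Q.PosDef) (hR : R.PosDef) (hRb : IsBlockDiag R)
    (h : IsSplitStep A B Q R i F P Fnew) (x : Fin m → ℝ) :
    ENNReal.ofReal (x ⬝ᵥ (P *ᵥ x)) ≤ value A B Q R F x := by
  refine (h.care.ofReal_le_cost (posDef_subQ hQ hR i F) (posDef_subR hR i)
    (isTrajectory_closedLoop (subA_add_subB_mul A B rfl) x)).trans_eq ?_
  refine lintegral_congr fun t => ?_
  have h1 := subQ_add_subR Q (posDef_iff_quadratic.1 hR).1 hRb (i := i) (F := F) (G := F) rfl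
  have hq : ∀ {α : Type} [Fintype α] (S : Matrix α α ℝ) (K : Matrix α (Fin m) ℝ) (y : Fin m → ℝ),
      (K *ᵥ y) ⬝ᵥ (S *ᵥ (K *ᵥ y)) = y ⬝ᵥ ((Kᵀ * S * K) *ᵥ y) := fun S K y => by
    rw [← Matrix.mulVec_mulVec, ← Matrix.mulVec_mulVec, Matrix.dotProduct_mulVec y Kᵀ,
      Matrix.vecMul_transpose]
  rw [hq, hq, ← dotProduct_add, ← dotProduct_add, ← Matrix.add_mulVec, ← Matrix.add_mulVec, h1]

theorem exists_isSplitStep (hQ : Q.PosDef) (hR : R.PosDef) {K : Matrix (Fin (r i)) (Fin m) ℝ}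
    (h : IsHurwitz (subA A B i F + subB B i * K)) : ∃ P Fnew, IsSplitStep A B Q R i F P Fnew := by
  obtain ⟨P, hP⟩ := exists_isCARESolution_of_isHurwitz (posDef_subQ hQ hR i F) (posDef_subR hR i) h
  refine ⟨P, coProj r i * F + blockCol r i * feedback (subB B i) (subR R i) P, hP, ?_, ?_⟩
  · rw [Matrix.mul_add, ← Matrix.mul_assoc, transpose_blockCol_mul_coProj, ← Matrix.mul_assoc,
      transpose_blockCol_mul_blockCol, Matrix.zero_mul, zero_add, Matrix.one_mul]
  · rw [Matrix.mul_add, ← Matrix.mul_assoc, coProj_mul_self, ← Matrix.mul_assoc,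
      coProj_mul_blockCol, Matrix.zero_mul, add_zero]

theorem IsSplitStep.unique (hQ : Q.PosDef) (hR : R.PosDef) {P' : Matrix (Fin m) (Fin m) ℝ}
    {Fnew' : Matrix (Inputs r) (Fin m) ℝ} (h : IsSplitStep A B Q R i F P Fnew)
    (h' : IsSplitStep A B Q R i F P' Fnew') : P = P' ∧ Fnew = Fnew' := by
  have hP := h.care.unique (posDef_subQ hQ hR i F) (posDef_subR hR i) h'.care
  refine ⟨hP, ?_⟩
  rw [← coProj_mul_add i Fnew, ← coProj_mul_add i Fnew', h.updated, h'.updated, h.unchanged,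
    h'.unchanged, hP]

end Step

/-! ### The cyclic iteration, its limit and common fixed points -/

section Iteration

variable {A : Matrix (Fin m) (Fin m) ℝ} {B : Matrix (Fin m) (Inputs r) ℝ}
  {Q : Matrix (Fin m) (Fin m) ℝ} {R : Matrix (Inputs r) (Inputs r) ℝ} {i : Fin n}
  {F₀ : Matrix (Inputs r) (Fin m) ℝ} {F : ℕ → Matrix (Inputs r) (Fin m) ℝ}
  {P : ℕ → Matrix (Fin m) (Fin m) ℝ}

theorem sweep_zero (i : Fin n) : sweep i 0 = i :=
  Fin.ext (Nat.mod_eq_of_lt i.isLt)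

theorem exists_le_sweep_eq (i j : Fin n) (N : ℕ) : ∃ l, N ≤ l ∧ sweep i l = j := by
  -- With this $l$ one has $i+l=j+n(N+1)$, which is $j$ modulo $n$.
  refine ⟨n * N + (n - i + j), ?_, Fin.ext ?_⟩
  · have : N ≤ n * N := Nat.le_mul_of_pos_left N i.pos
    omega
  · have h1 : (i : ℕ) + (n * N + (n - i + j)) = j + n * (N + 1) := by
      have := i.isLt
      rw [Nat.mul_succ]
      omega
    simp only [sweep]
    rw [h1, Nat.add_mul_mod_self_left, Nat.mod_eq_of_lt j.isLt]

/-- Solvability propagates: after a step the full closed loop is Hurwitz, so the existing rows of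
the next subsystem stabilize its subproblem. -/
theorem exists_isSplitIteration (hQ : Q.PosDef) (hR : R.PosDef) (hRb : IsBlockDiag R)
    {K : Matrix (Fin (r i)) (Fin m) ℝ} (h : IsHurwitz (subA A B i F₀ + subB B i * K)) :
    ∃ F P, IsSplitIteration A B Q R i F₀ F P := by
  let Good : ℕ → Matrix (Inputs r) (Fin m) ℝ → Prop := fun k F =>
    ∃ K : Matrix (Fin (r (sweep i k))) (Fin m) ℝ,
      IsHurwitz (subA A B (sweep i k) F + subB B (sweep i k) * K)
  -- Stated as an implication, so that the step can be chosen for every $F$; the value $0$ at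
  -- unsuitable $F$ is never reached.
  have hstep : ∀ k F, ∃ p : Matrix (Fin m) (Fin m) ℝ × Matrix (Inputs r) (Fin m) ℝ,
      Good k F → IsSplitStep A B Q R (sweep i k) F p.1 p.2 ∧ Good (k + 1) p.2 := fun k F => by
    by_cases hg : Good k F
    · obtain ⟨K, hK⟩ := hg
      obtain ⟨P, Fnew, hs⟩ := exists_isSplitStep hQ hR hK
      refine ⟨(P, Fnew), fun _ => ⟨hs, (blockCol r (sweep i (k + 1)))ᵀ * Fnew, ?_⟩⟩
      rw [subA_add_subB_mul A B rfl]
      exact hs.isHurwitz hQ hR hRb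
    · exact ⟨0, fun h => (hg h).elim⟩
  choose p hp using hstep
  let F : ℕ → Matrix (Inputs r) (Fin m) ℝ := fun k => Nat.rec F₀ (fun k F => (p k F).2) k
  have hgood : ∀ k, Good k (F k) := fun k => by
    induction k with
    | zero =>
      have hj : ∀ j, j = i → ∃ K : Matrix (Fin (r j)) (Fin m) ℝ,
          IsHurwitz (subA A B j F₀ + subB B j * K) := by
        rintro _ rfl
        exact ⟨K, h⟩
      exact hj _ (sweep_zero i)
    | succ k ih => exact (hp k (F k) ih).2
  exact ⟨F, fun k => (p (k - 1) (F (k - 1))).1, rfl, fun k => (hp k (F k) (hgood k)).1⟩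

theorem IsSplitIteration.unique (hQ : Q.PosDef) (hR : R.PosDef)
    {F' : ℕ → Matrix (Inputs r) (Fin m) ℝ} {P' : ℕ → Matrix (Fin m) (Fin m) ℝ}
    (h' : IsSplitIteration A B Q R i F₀ F' P') (h : IsSplitIteration A B Q R i F₀ F P) :
    F' = F ∧ ∀ k, 1 ≤ k → P' k = P k := by
  have hF : ∀ k, F' k = F k := fun k => by
    induction k with
    | zero => rw [h'.init, h.init]
    | succ k ih => exact ((ih ▸ h'.step k).unique hQ hR (h.step k)).2
  refine ⟨funext hF, fun k hk => ?_⟩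
  obtain ⟨k, rfl⟩ := Nat.exists_eq_add_of_le' hk
  exact ((hF k ▸ h'.step k).unique hQ hR (h.step k)).1

theorem IsSplitIteration.posSemidef_sub (hQ : Q.PosDef) (hR : R.PosDef) (hRb : IsBlockDiag R)
    (h : IsSplitIteration A B Q R i F₀ F P) (k : ℕ) : (P (k + 1) - P (k + 2)).PosSemidef := by
  refine posSemidef_iff_quadratic.2 ⟨?_, fun x => ?_⟩
  · rw [Matrix.transpose_sub, (posDef_iff_quadratic.1 (h.step k).care.1).1,
      (posDef_iff_quadratic.1 (h.step (k + 1)).care.1).1]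
  · have h1 := ((h.step (k + 1)).ofReal_le_value hQ hR hRb x).trans_eq
      ((h.step k).value_eq hQ hR hRb x)
    rw [ENNReal.ofReal_le_ofReal_iff
      ((posSemidef_iff_quadratic.1 (h.step k).care.1.posSemidef).2 x)] at h1
    rw [Matrix.sub_mulVec, dotProduct_sub]
    linarith

/-- Once subsystem `j` has been updated, its feedback always comes from a past Riccati solution. -/
theorem IsSplitIteration.exists_block_eq (h : IsSplitIteration A B Q R i F₀ F P) {j : Fin n}
    {l : ℕ} (hl : sweep i l = j) {k : ℕ} (hk : l + 1 ≤ k) :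
    ∃ l', l ≤ l' ∧ (blockCol r j)ᵀ * F k = feedback (subB B j) (subR R j) (P (l' + 1)) := by
  induction k, hk using Nat.le_induction with
  | base => exact ⟨l, le_rfl, by subst hl; exact (h.step l).updated⟩
  | succ k hk ih =>
    by_cases hj : sweep i k = j
    · exact ⟨k, by omega, by subst hj; exact (h.step k).updated⟩
    · rwa [transpose_blockCol_mul_of_coProj_mul_eq hj (h.step k).unchanged]

/-- All block rows eventually come from late Riccati solutions, which share one limit. The Lyapunov
equation is then passed to the limit, as its form does not depend on the subsystem just updated. -/
theorem IsSplitIteration.tendsto (hQ : Q.PosDef) (hR : R.PosDef) (hRb : IsBlockDiag R)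
    (h : IsSplitIteration A B Q R i F₀ F P) :
    ∃ L, IsCARESolution A B Q R L ∧ Tendsto F atTop (𝓝 (feedback B R L)) := by
  obtain ⟨L, hL, hlim⟩ := exists_tendsto_of_loewner_antitone (P := fun k => P (k + 1))
    (fun k => (h.step k).care.1.posSemidef) (h.posSemidef_sub hQ hR hRb)
  have hblock : ∀ j, Tendsto (fun k => (blockCol r j)ᵀ * F k) atTop
      (𝓝 ((blockCol r j)ᵀ * feedback B R L)) := fun j => by
    rw [transpose_blockCol_mul_feedback B hR hRb]
    have hc : Continuous fun S => feedback (subB B j) (subR R j) S := by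
      unfold feedback
      fun_prop
    have h1 := (hc.tendsto L).comp hlim
    -- The index $l'$ of the last update varies with $k$; it suffices that it eventually exceeds any
    -- given $N$.
    intro U hU
    obtain ⟨N, hN⟩ := eventually_atTop.1 (h1 hU)
    obtain ⟨l, hl, hlj⟩ := exists_le_sweep_eq i j N
    refine mem_map.2 ?_
    filter_upwards [eventually_ge_atTop (l + 1)] with k hk
    obtain ⟨l', hl', heq⟩ := h.exists_block_eq hlj hk
    rw [Set.mem_preimage, heq]
    exact hN l' (hl.trans hl')
  have hF : Tendsto F atTop (𝓝 (feedback B R L)) := by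
    refine tendsto_pi_nhds.2 fun ⟨j, a⟩ => tendsto_pi_nhds.2 fun b => ?_
    have h1 := tendsto_pi_nhds.1 (tendsto_pi_nhds.1 (hblock j) a) b
    simpa only [transpose_blockCol_mul_apply] using h1
  have hc : Continuous fun p : Matrix (Inputs r) (Fin m) ℝ × Matrix (Fin m) (Fin m) ℝ =>
      (A + B * p.1)ᵀ * p.2 + p.2 * (A + B * p.1) + (Q + p.1ᵀ * R * p.1) := by
    fun_prop
  have h2 := (hc.tendsto (feedback B R L, L)).comp
    ((hF.comp (tendsto_add_atTop_nat 1)).prodMk_nhds hlim)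
  have h3 := tendsto_nhds_unique h2
    (tendsto_const_nhds.congr fun k => ((h.step k).lyapunov hR hRb).symm)
  exact ⟨L, ⟨posDef_of_lyapunov hL (posDef_add_transpose_mul_mul hQ hR _) h3,
    (lyapunov_feedback_iff A B Q hR (posSemidef_iff_quadratic.1 hL).1).1 h3⟩, hF⟩

/-- All $S_j$ solve the Lyapunov equation of the same Hurwitz matrix $A+BG$, so they coincide, and
the block rows of $G$ assemble to the full feedback of this one matrix. -/
theorem isCARESolution_of_common_fixed_point (hQ : Q.PosDef) (hR : R.PosDef)
    (hRb : IsBlockDiag R) {G : Matrix (Inputs r) (Fin m) ℝ} {S : Fin n → Matrix (Fin m) (Fin m) ℝ}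
    (h : ∀ j, IsSplitStep A B Q R j G (S j) G) (i : Fin n) :
    IsCARESolution A B Q R (S i) ∧ G = feedback B R (S i) := by
  have hS : ∀ j, S j = S i := fun j => by
    refine sub_eq_zero.1 (((h i).isHurwitz hQ hR hRb).eq_zero_of_lyapunov ?_)
    calc (A + B * G)ᵀ * (S j - S i) + (S j - S i) * (A + B * G)
        = ((A + B * G)ᵀ * S j + S j * (A + B * G) + (Q + Gᵀ * R * G)) -
            ((A + B * G)ᵀ * S i + S i * (A + B * G) + (Q + Gᵀ * R * G)) := by
          rw [Matrix.mul_sub, Matrix.sub_mul]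
          abel
      _ = 0 := by rw [(h j).lyapunov hR hRb, (h i).lyapunov hR hRb, sub_zero]
  have hG : G = feedback B R (S i) := eq_of_transpose_blockCol_mul_eq fun j => by
    rw [transpose_blockCol_mul_feedback B hR hRb, (h j).updated, hS]
  refine ⟨⟨(h i).care.1, ?_⟩, hG⟩
  rw [← lyapunov_feedback_iff A B Q hR (posDef_iff_quadratic.1 (h i).care.1).1, ← hG]
  exact (h i).lyapunov hR hRb

end Iteration

end Split

end SplitLQR

theorem theorem1 {m n : ℕ} {r : Fin n → ℕ}
    (A : Matrix (Fin m) (Fin m) ℝ) (B : Matrix (Fin m) (SplitLQR.Inputs r) ℝ)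
    (Q : Matrix (Fin m) (Fin m) ℝ) (R : Matrix (SplitLQR.Inputs r) (SplitLQR.Inputs r) ℝ)
    (hQ : Q.PosDef) (hR : R.PosDef) (hRblock : SplitLQR.IsBlockDiag R)
    (F₀ : Matrix (SplitLQR.Inputs r) (Fin m) ℝ) (i : Fin n)
    (hctrl : SplitLQR.IsControllable (SplitLQR.subA A B i F₀) (SplitLQR.subB B i)) :
    -- the iteration is well defined
    (∃ (F : ℕ → Matrix (SplitLQR.Inputs r) (Fin m) ℝ) (P : ℕ → Matrix (Fin m) (Fin m) ℝ),
      SplitLQR.IsSplitIteration A B Q R i F₀ F P ∧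
      ∀ (F' : ℕ → Matrix (SplitLQR.Inputs r) (Fin m) ℝ) (P' : ℕ → Matrix (Fin m) (Fin m) ℝ),
        SplitLQR.IsSplitIteration A B Q R i F₀ F' P' → F' = F ∧ ∀ k, 1 ≤ k → P' k = P k) ∧
    -- the original problem has the optimal value matrix `Popt` and the optimal feedback `Fopt`
    ∃ (Popt : Matrix (Fin m) (Fin m) ℝ) (Fopt : Matrix (SplitLQR.Inputs r) (Fin m) ℝ),
      (∀ P : Matrix (Fin m) (Fin m) ℝ, SplitLQR.IsCARESolution A B Q R P ↔ P = Popt) ∧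
      Fopt = SplitLQR.feedback B R Popt ∧
      (∀ F : Matrix (SplitLQR.Inputs r) (Fin m) ℝ,
        SplitLQR.IsOptimalFeedback A B Q R F ↔ F = Fopt) ∧
      (∀ x : Fin m → ℝ, SplitLQR.value A B Q R Fopt x = ENNReal.ofReal (x ⬝ᵥ (Popt *ᵥ x))) ∧
      -- stabilization, monotonicity and convergence along the iteration
      (∀ (F : ℕ → Matrix (SplitLQR.Inputs r) (Fin m) ℝ) (P : ℕ → Matrix (Fin m) (Fin m) ℝ),
        SplitLQR.IsSplitIteration A B Q R i F₀ F P →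
          (∀ k, 1 ≤ k → SplitLQR.IsStabilizing A B (F k)) ∧
          (∀ k, ∀ x : Fin m → ℝ,
            SplitLQR.value A B Q R (F (k + 1)) x ≤ SplitLQR.value A B Q R (F k) x) ∧
          (∀ k, 1 ≤ k → ∀ x : Fin m → ℝ,
            SplitLQR.value A B Q R (F k) x = ENNReal.ofReal (x ⬝ᵥ (P k *ᵥ x))) ∧
          (∀ k, 1 ≤ k → (P k - P (k + 1)).PosSemidef) ∧
          Tendsto F atTop (𝓝 Fopt)) ∧
      -- every common fixed point of the update steps solves the full Riccati equation
      (∀ (G : Matrix (SplitLQR.Inputs r) (Fin m) ℝ) (S : Fin n → Matrix (Fin m) (Fin m) ℝ),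
        (∀ j, SplitLQR.IsSplitStep A B Q R j G (S j) G) →
          (∀ j, SplitLQR.IsCARESolution A B Q R (S j)) ∧ G = Fopt) := by
  obtain ⟨K, hK⟩ := SplitLQR.exists_isHurwitz_of_isControllable hctrl
  obtain ⟨F, P, hFP⟩ := SplitLQR.exists_isSplitIteration hQ hR hRblock hK
  refine ⟨⟨F, P, hFP, fun F' P' h' => h'.unique hQ hR hFP⟩, ?_⟩
  -- The first iterate stabilizes the full system, which makes the full Riccati equation solvable
  -- without further assumptions on $(A,B)$.
  obtain ⟨Popt, hPopt⟩ := SplitLQR.exists_isCARESolution_of_isHurwitz hQ hR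
    ((hFP.step 0).isHurwitz hQ hR hRblock)
  refine ⟨Popt, SplitLQR.feedback B R Popt,
    fun S => ⟨fun hS => hS.unique hQ hR hPopt, fun hS => hS ▸ hPopt⟩, rfl,
    fun G => hPopt.isOptimalFeedback_iff hQ hR, hPopt.value_feedback hQ hR,
    fun F P h => ⟨?_, ?_, ?_, ?_, ?_⟩, fun G S hS => ⟨fun j => ?_, ?_⟩⟩
  · intro k hk
    obtain ⟨k, rfl⟩ := Nat.exists_eq_add_of_le' hk
    exact (h.step k).isHurwitz hQ hR hRblock
  · intro k x
    exact ((h.step k).value_eq hQ hR hRblock x).trans_le ((h.step k).ofReal_le_value hQ hR hRblock x)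
  · intro k hk
    obtain ⟨k, rfl⟩ := Nat.exists_eq_add_of_le' hk
    exact (h.step k).value_eq hQ hR hRblock
  · intro k hk
    obtain ⟨k, rfl⟩ := Nat.exists_eq_add_of_le' hk
    exact h.posSemidef_sub hQ hR hRblock k
  · obtain ⟨L, hL, hF⟩ := h.tendsto hQ hR hRblock
    rwa [hL.unique hQ hR hPopt] at hF
  · exact (SplitLQR.isCARESolution_of_common_fixed_point hQ hR hRblock hS j).1
  · obtain ⟨h1, h2⟩ := SplitLQR.isCARESolution_of_common_fixed_point hQ hR hRblock hS i
    rw [h2, h1.unique hQ hR hPopt]
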